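/- **Theorem (Multi-Step Policy Gradient).** Consider a discounted Markov decision process with a measurable observation (state) space $\mathcal O$, action space $\mathbb R^{d}$, initial law $\rho_0$, transition kernel $P(\cdot\mid o,a)$, measurable reward $r(o,a)$ and discount factor $\gamma\in[0,1)$. Let $K\ge 1$, $\sigma>0$, $\tau_k=1-k/K$, $\Delta\tau_k=\tau_k-\tau_{k+1}=1/K$, and let $u_\vartheta(a,r,\tau,o)\in\mathbb R^d$, $\vartheta\in\mathbb R^p$, be a parametrized velocity field, measurable in $(a,r,\tau,o)$ for each $\vartheta$. Given $o$, the MeanFlow policy generates the denoising chain $a^{0:K}=(a^0,\dots,a^K)$, $$a^0\sim\mathcal N(0,I),\qquad a^{k+1}\sim\pi_\vartheta(\cdot\mid a^k,o)=\mathcal N\big(a^k-\Delta\tau_k\,u_\vartheta(a^k,\tau_{k+1},\tau_k,o),\ \sigma^2I\big),\quad 0\le k<K,$$ and executes $a=a^K$; the law of $a^K$ given $o$ is $\pi_\vartheta(\cdot\mid o)$. Let $\ln\pi_\vartheta(a^{k+1}\mid a^k,o)$ be the log-density of the $k$-th transition. For rollouts $(o_t,a_t)_{t\ge0}$ of $\pi_\vartheta$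 put $J(\pi_\vartheta)=\mathbb E[\sum_{t\ge0}\gamma^t r(o_t,a_t)]$ with $o_0\sim\rho_0$, $V^{\pi_\vartheta}(o)=\mathbb E[\sum_t\gamma^t r(o_t,a_t)\mid o_0=o]$, $Q^{\pi_\vartheta}(o,a)=\mathbb E[\sum_t\gamma^t r(o_t,a_t)\mid o_0=o,a_0=a]$, $A^{\pi_\vartheta}=Q^{\pi_\vartheta}-V^{\pi_\vartheta}$, and let $d_\vartheta=\sum_{t\ge0}\gamma^t\,\mathbb P_{\pi_\vartheta}(o_t\in\cdot)$ be the discounted visitation measure, of total mass $1/(1-\gamma)$. Fix $\theta\in\mathbb R^p$ and suppose that there are $C$, $m$ and $\varepsilon>0$ such that $|r(o,a)|\le C(1+\|a\|)^m$ for all $o,a$, and such that for all $\theta'$ with $\|\theta'-\theta\|<\varepsilon$, all $k<K$ and all $a,o$ the map $\vartheta\mapsto u_\vartheta(a,\tau_{k+1},\tau_k,o)$ is differentiable at $\theta'$, and both its value and its derivative at $\theta'$ have norm at most $C(1+\|a\|)^m$. Then, for all $\theta'$ in a neighbourhood of $\theta$, the returns defining $J(\pi_{\theta'})$, $V^{\pi_{\theta'}}(o)$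 and $Q^{\pi_{\theta'}}(o,a)$ (for all $o,a$) converge absolutely in expectation; moreover $\vartheta\mapsto J(\pi_\vartheta)$ is differentiable at $\theta$, and $$\nabla_\theta J(\pi_\theta)=\mathbb E_{o,\,a^{0:K}\sim\pi_\theta}\Big[A^{\pi_\theta}(o,a^K)\,\nabla_\theta\sum_{k=0}^{K-1}\ln\pi_\theta(a^{k+1}\mid a^k,o)\Big],$$ where $\mathbb E_{o,\,a^{0:K}\sim\pi_\theta}$ denotes integration with $o$ distributed according to the (unnormalized) discounted visitation measure $d_\theta$ and $a^{0:K}$ the denoising chain given $o$, and the integrand is integrable. (Equivalently, the right-hand side is $1/(1-\gamma)$ times the expectation with $o$ drawn from the probability measure $(1-\gamma)d_\theta$.) -/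

import Mathlib

open MeasureTheory ProbabilityTheory
open scoped MatrixOrder

noncomputable section

/-! ## The `K`-step MeanFlow policy -/

/-- The action space `ℝ^d` with its Euclidean norm. -/
abbrev Act (d : ℕ) : Type := EuclideanSpace ℝ (Fin d)

/-- An average velocity field `u(a, r, τ, o)`: `a` is the current denoising state, `[r, τ]` is the
flow-time interval (start first, end second), and `o` is the observation. -/
structure VelocityField (d : ℕ) (O : Type*) [MeasurableSpace O] where
  toFun : Act d → ℝ → ℝ → O → Act d
  measurable_toFun : Measurable fun x : Act d × ℝ × ℝ × O => toFun x.1 x.2.1 x.2.2.1 x.2.2.2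

/-- Flow time `τ_k = 1 - k / K`. -/
def flowTime (K k : ℕ) : ℝ := 1 - (k : ℝ) / (K : ℝ)

namespace VelocityField

variable {d : ℕ} {O : Type*} [MeasurableSpace O]

/-- The mean `μ_k = a - (τ_k - τ_{k+1}) u(a, τ_{k+1}, τ_k, o)` of the `k`-th transition. -/
def mean (u : VelocityField d O) (K k : ℕ) (o : O) (a : Act d) : Act d :=
  a - (flowTime K k - flowTime K (k + 1)) • u.toFun a (flowTime K (k + 1)) (flowTime K k) o

theorem measurable_mean (u : VelocityField d O) (K k : ℕ) :
    Measurable fun x : O × Act d => u.mean K k x.1 x.2 := by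
  have h : Measurable fun x : O × Act d =>
      u.toFun x.2 (flowTime K (k + 1)) (flowTime K k) x.1 :=
    u.measurable_toFun.comp
      (measurable_snd.prodMk (measurable_const.prodMk (measurable_const.prodMk measurable_fst)))
  exact measurable_snd.sub (h.const_smul (flowTime K k - flowTime K (k + 1)))

/-- The transition kernel: given `(o, a^k)`, the state `a^{k+1}` has law `N(μ_k, σ² I)`. -/
def transition (u : VelocityField d O) (σ : ℝ) (K k : ℕ) : Kernel (O × Act d) (Act d) where
  toFun x := multivariateGaussian (u.mean K k x.1 x.2) (σ ^ 2 • (1 : Matrix (Fin d) (Fin d) ℝ))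
  measurable' := by
    refine Measure.measurable_of_measurable_coe _ fun s hs => ?_
    have hf : Measurable fun p : (O × Act d) × Act d => u.mean K k p.1.1 p.1.2 +
        Matrix.toEuclideanCLM (𝕜 := ℝ)
          (CFC.sqrt (σ ^ 2 • (1 : Matrix (Fin d) (Fin d) ℝ))) p.2 :=
      ((u.measurable_mean K k).comp measurable_fst).add
        ((ContinuousLinearMap.measurable _).comp measurable_snd)
    have h := measurable_measure_prodMk_left (ν := stdGaussian (Act d)) (hf hs)
    convert h using 2 with x
    rw [multivariateGaussian, Measure.map_apply (by fun_prop) hs]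
    rfl

instance (u : VelocityField d O) (σ : ℝ) (K k : ℕ) : IsMarkovKernel (u.transition σ K k) :=
  ⟨fun x => inferInstanceAs (IsProbabilityMeasure
    (multivariateGaussian (u.mean K k x.1 x.2) (σ ^ 2 • (1 : Matrix (Fin d) (Fin d) ℝ))))⟩

/-- The density `π(a' | a, o)` of the `k`-th transition: the density of `N(μ_k, σ² I)` at `a'`. -/
def transitionDensity (u : VelocityField d O) (σ : ℝ) (K k : ℕ) (o : O) (a a' : Act d) : ℝ :=
  (2 * Real.pi * σ ^ 2) ^ (-(d : ℝ) / 2) *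
    Real.exp (-‖a' - u.mean K k o a‖ ^ 2 / (2 * σ ^ 2))

/-- The law of the first `n + 1` states `(a^0, …, a^n)` of the denoising chain given `o`, where
`a^0 ∼ N(0, I)` and each next state is drawn from the transition kernel. -/
def chain (u : VelocityField d O) (σ : ℝ) (K : ℕ) : (n : ℕ) → Kernel O (Fin (n + 1) → Act d)
  | 0 => Kernel.const O ((stdGaussian (Act d)).map fun a _ => a)
  | n + 1 =>
    (u.chain σ K n ⊗ₖ (u.transition σ K n).comap
      (fun x : O × (Fin (n + 1) → Act d) => (x.1, x.2 (Fin.last n))) (by fun_prop)).map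
      fun p => Fin.snoc (α := fun _ => Act d) p.1 p.2

theorem measurable_snoc (n : ℕ) : Measurable fun p : (Fin n → Act d) × Act d =>
    (Fin.snoc (α := fun _ => Act d) p.1 p.2 : Fin (n + 1) → Act d) := by
  refine measurable_pi_lambda _ fun i => ?_
  refine Fin.lastCases ?_ (fun j => ?_) i
  · simpa using measurable_snd
  · simpa [Function.comp_def] using (measurable_pi_apply j).comp measurable_fst

instance (u : VelocityField d O) (σ : ℝ) (K n : ℕ) : IsMarkovKernel (u.chain σ K n) := by
  induction n with
  | zero =>
    have : IsProbabilityMeasure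
        ((stdGaussian (Act d)).map fun (a : Act d) (_ : Fin (0 + 1)) => a) :=
      Measure.isProbabilityMeasure_map (by fun_prop)
    unfold chain
    infer_instance
  | succ n ih =>
    unfold chain
    exact Kernel.IsMarkovKernel.map _ (measurable_snoc (n + 1))

/-- The policy `π(a | o)`: the law of the final state `a = a^K` of the `K`-step chain. -/
def policy (u : VelocityField d O) (σ : ℝ) (K : ℕ) : Kernel O (Act d) :=
  (u.chain σ K K).map fun a => a (Fin.last K)

instance (u : VelocityField d O) (σ : ℝ) (K : ℕ) : IsMarkovKernel (u.policy σ K) :=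
  Kernel.IsMarkovKernel.map _ (measurable_pi_apply _)

end VelocityField

/-! ## The environment -/

/-- A discounted Markov decision process with observation (state) space `O` and action space
`A`. -/
structure MDP (O A : Type*) [MeasurableSpace O] [MeasurableSpace A] where
  /-- law of the initial observation -/
  init : Measure O
  init_prob : IsProbabilityMeasure init
  /-- law of the next observation -/
  next : Kernel (O × A) O
  next_markov : IsMarkovKernel next
  reward : O → A → ℝ
  measurable_reward : Measurable fun x : O × A => reward x.1 x.2
  /-- discount factor -/
  γ : ℝ
  γ_nonneg : 0 ≤ γ
  γ_lt_one : γ < 1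

namespace MDP

variable {O A : Type*} [MeasurableSpace O] [MeasurableSpace A]

instance (M : MDP O A) : IsProbabilityMeasure M.init := M.init_prob

instance (M : MDP O A) : IsMarkovKernel M.next := M.next_markov

/-- One step `(o_t, a_t) ↦ (o_{t+1}, a_{t+1})` under the policy `π`. -/
def step (M : MDP O A) (π : Kernel O A) : Kernel (O × A) (O × A) :=
  M.next ⊗ₖ π.prodMkLeft (O × A)

instance (M : MDP O A) (π : Kernel O A) [IsMarkovKernel π] : IsMarkovKernel (M.step π) := by
  unfold step
  infer_instance

/-- The law of the rollout `(o_t, a_t)_{t ≥ 0}` under `π`, given `(o_0, a_0)`. -/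
def rolloutFromPair (M : MDP O A) (π : Kernel O A) [IsMarkovKernel π] :
    Kernel (O × A) (ℕ → O × A) :=
  (Kernel.traj (X := fun _ => O × A) (fun n => (M.step π).comap
    (fun h : (Finset.Iic n) → O × A => h ⟨n, Finset.mem_Iic.2 le_rfl⟩) (by fun_prop)) 0).comap
    (fun x _ => x) (by fun_prop)

instance (M : MDP O A) (π : Kernel O A) [IsMarkovKernel π] :
    IsMarkovKernel (M.rolloutFromPair π) := by
  unfold rolloutFromPair
  infer_instance

/-- The law of the rollout under `π`, given `o_0`. -/
def rolloutFromObs (M : MDP O A) (π : Kernel O A) [IsMarkovKernel π] : Kernel O (ℕ → O × A) :=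
  M.rolloutFromPair π ∘ₖ (Kernel.id ×ₖ π)

instance (M : MDP O A) (π : Kernel O A) [IsMarkovKernel π] :
    IsMarkovKernel (M.rolloutFromObs π) := by
  unfold rolloutFromObs
  infer_instance

/-- The law of the rollout under `π`, with `o_0` drawn from the initial law. -/
def rollout (M : MDP O A) (π : Kernel O A) [IsMarkovKernel π] : Measure (ℕ → O × A) :=
  M.rolloutFromObs π ∘ₘ M.init

instance (M : MDP O A) (π : Kernel O A) [IsMarkovKernel π] :
    IsProbabilityMeasure (M.rollout π) := by
  unfold rollout
  infer_instance

/-- The discounted return `∑_t γ^t r(o_t, a_t)` of a rollout. -/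
def discountedReturn (M : MDP O A) (ω : ℕ → O × A) : ℝ :=
  ∑' t, M.γ ^ t * M.reward (ω t).1 (ω t).2

/-- The sum `∑_t |γ^t r(o_t, a_t)|`, with values in `[0, ∞]`. -/
def absReturn (M : MDP O A) (ω : ℕ → O × A) : ENNReal :=
  ∑' t, ‖M.γ ^ t * M.reward (ω t).1 (ω t).2‖ₑ

/-- `J(π)`, the expected discounted return. -/
def J (M : MDP O A) (π : Kernel O A) [IsMarkovKernel π] : ℝ :=
  ∫ ω, M.discountedReturn ω ∂(M.rollout π)

/-- The value function `V^π(o)`. -/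
def value (M : MDP O A) (π : Kernel O A) [IsMarkovKernel π] (o : O) : ℝ :=
  ∫ ω, M.discountedReturn ω ∂(M.rolloutFromObs π o)

/-- The state-action value function `Q^π(o, a)`. -/
def qValue (M : MDP O A) (π : Kernel O A) [IsMarkovKernel π] (o : O) (a : A) : ℝ :=
  ∫ ω, M.discountedReturn ω ∂(M.rolloutFromPair π (o, a))

/-- The advantage function `A^π(o, a) = Q^π(o, a) - V^π(o)`. -/
def advantage (M : MDP O A) (π : Kernel O A) [IsMarkovKernel π] (o : O) (a : A) : ℝ :=
  M.qValue π o a - M.value π o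

/-- The discounted visitation measure `∑_t γ^t P(o_t ∈ ·)` of the observations in rollouts of
`π`; its total mass is `1 / (1 - γ)`. -/
def visitation (M : MDP O A) (π : Kernel O A) [IsMarkovKernel π] : Measure O :=
  Measure.sum fun t => ENNReal.ofReal (M.γ ^ t) • (M.rollout π).map fun ω => (ω t).1

instance (M : MDP O A) (π : Kernel O A) [IsMarkovKernel π] :
    IsFiniteMeasure (M.visitation π) := by
  refine ⟨?_⟩
  have h : ∀ t, ((M.rollout π).map fun ω => (ω t).1) Set.univ = 1 := fun t => by
    rw [Measure.map_apply (by fun_prop) MeasurableSet.univ]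
    simp
  simp only [visitation, Measure.sum_apply _ MeasurableSet.univ, Measure.smul_apply, h,
    smul_eq_mul, mul_one]
  exact (summable_geometric_of_lt_one M.γ_nonneg M.γ_lt_one).tsum_ofReal_lt_top

end MDP

end

open scoped ENNReal NNReal RealInnerProductSpace

namespace MeasureTheory.Measure

/-! Write `π'` and `π` for the policies at `θ'` and `θ`. The performance difference lemma expresses
`J π' - J π` exactly as the integral of the advantage `A` of the old policy `π` over observations
visited by the new policy `π'` and actions drawn from it (`MDP.performance_difference`). Put
`f_θ'(o) = ∫ A(o, a) π'(da | o)`. Replacing the visitation measure of `π'` by that of `π` gives `J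
π' - J π = Φ(θ') + R(θ')`, where `Φ` integrates `f_θ'` against the frozen measure and `R` is the
error of the replacement.

The error is quadratic. Since the advantage has mean zero under `π`, `f_θ = 0`, and `f_θ'` is of
size `‖θ' - θ‖` uniformly in `o`. The visitation measure, tested on functions bounded by `β`, also
moves by at most a constant times `β ‖θ' - θ‖` (`abs_integral_visitation_sub_le`). Hence `R` has
derivative zero at `θ`, and the visitation measure itself need never be differentiated.

In `Φ` the parameter enters only through the density of the denoising chain, a product of Gaussian
factors over a fixed reference measure. Differentiation under the integral and `∇p = p ∇ log p` give
the formula (`integrable_and_hasGradientAt`). The policy is a marginal of the chain, so its own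
density never appears.

Both estimates rest on one integrable envelope for the chain densities, uniform in the parameter
near `θ` and in the observation, with polynomial moments to spare (`exists_chainDensity_le`).
Polynomial decay of the Gaussian in its argument is traded for polynomial growth in its mean, one
transition at a time. -/

theorem integral_comp_kernel {α β : Type*} {mα : MeasurableSpace α} {mβ : MeasurableSpace β}
    {E : Type*} [NormedAddCommGroup E] [NormedSpace ℝ E] {κ : Kernel α β} {μ : Measure α}
    {f : β → E} (hf : Integrable f (κ ∘ₘ μ)) :
    ∫ y, f y ∂(κ ∘ₘ μ) = ∫ x, ∫ y, f y ∂κ x ∂μ := by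
  rw [Measure.comp_eq_comp_const_apply] at hf ⊢
  rw [Kernel.integral_comp hf, Kernel.const_apply]

end MeasureTheory.Measure

/-! ### Rollout laws, discounted occupancy measures and returns. -/

namespace MDP

variable {O A : Type*} [MeasurableSpace O] [MeasurableSpace A]

/-- The law of `(o_t, a_t)` given `(o_0, a_0)`. -/
noncomputable def timeLaw (M : MDP O A) (π : Kernel O A) [IsMarkovKernel π] (t : ℕ) :
    Kernel (O × A) (O × A) :=
  (M.rolloutFromPair π).map fun ω => ω t

instance (M : MDP O A) (π : Kernel O A) [IsMarkovKernel π] (t : ℕ) :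
    IsMarkovKernel (M.timeLaw π t) :=
  Kernel.IsMarkovKernel.map _ (measurable_pi_apply t)

theorem timeLaw_zero (M : MDP O A) (π : Kernel O A) [IsMarkovKernel π] :
    M.timeLaw π 0 = Kernel.id := by
  set κ : (n : ℕ) → Kernel ((i : Finset.Iic n) → O × A) (O × A) := fun n => (M.step π).comap
      (fun h : (Finset.Iic n) → O × A => h ⟨n, Finset.mem_Iic.2 le_rfl⟩) (by fun_prop) with hκ
  have h : (Kernel.traj (X := fun _ => O × A) κ 0).map (fun ω => ω 0) =
      Kernel.id.map (fun y : (Finset.Iic 0) → O × A => y ⟨0, Finset.mem_Iic.2 le_rfl⟩) := by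
    have h' := Kernel.traj_map_frestrictLe (X := fun _ => O × A) (κ := κ) 0 0
    rw [Kernel.partialTraj_self] at h'
    rw [← h', ← Kernel.map_comp_right]
    · rfl
    · fun_prop
    · fun_prop
  ext x : 1
  have h' := congrArg (fun κ => κ (fun _ => x)) h
  simp only [timeLaw, rolloutFromPair, Kernel.map_apply _ (measurable_pi_apply _),
    Kernel.comap_apply, Kernel.id_apply] at h' ⊢
  rw [Measure.map_dirac' (by fun_prop)] at h'
  exact h'

theorem timeLaw_succ (M : MDP O A) (π : Kernel O A) [IsMarkovKernel π] (t : ℕ) :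
    M.timeLaw π (t + 1) = M.step π ∘ₖ M.timeLaw π t := by
  set κ : (n : ℕ) → Kernel ((i : Finset.Iic n) → O × A) (O × A) := fun n => (M.step π).comap
      (fun h : (Finset.Iic n) → O × A => h ⟨n, Finset.mem_Iic.2 le_rfl⟩) (by fun_prop) with hκ
  have h : (Kernel.traj (X := fun _ => O × A) κ 0).map (fun ω => ω (t + 1)) =
      M.step π ∘ₖ (Kernel.traj (X := fun _ => O × A) κ 0).map (fun ω => ω t) := by
    -- Split the trajectory at time `t`. Given the history up to `t`, the next coordinate has law `κ
    -- t`, which reads only the last state of that history: this is the Markov property.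
    rw [← Kernel.traj_comp_partialTraj (X := fun _ => O × A) (κ := κ) (Nat.zero_le t),
      Kernel.map_comp, Kernel.map_traj_succ_self, Kernel.traj_comp_partialTraj (Nat.zero_le t),
      ← Kernel.traj_map_frestrictLe, show κ t = (M.step π).comap
        (fun h : (Finset.Iic t) → O × A => h ⟨t, Finset.mem_Iic.2 le_rfl⟩) (by fun_prop) from rfl,
      ← Kernel.comp_map, ← Kernel.map_comp_right]
    · rfl
    · fun_prop
    · fun_prop
  ext x : 1
  have h' := congrArg (fun κ => κ (fun _ => x)) h
  rw [Kernel.comp_apply] at h' ⊢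
  simp only [timeLaw, rolloutFromPair, Kernel.map_apply _ (measurable_pi_apply _),
    Kernel.comap_apply] at h' ⊢
  exact h'

/-- Both sides are the `(t + 1)`-st power of the one-step kernel. Splitting off the first step
yields the Bellman equation, splitting off the last one the flow equation. -/
theorem timeLaw_succ' (M : MDP O A) (π : Kernel O A) [IsMarkovKernel π] (t : ℕ) :
    M.timeLaw π (t + 1) = M.timeLaw π t ∘ₖ M.step π := by
  induction t with
  | zero => rw [timeLaw_succ, timeLaw_zero, Kernel.comp_id, Kernel.id_comp]
  | succ t ih => rw [timeLaw_succ, ih, ← Kernel.comp_assoc, ← timeLaw_succ, ih]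

/-- The law of the rollout when `(o_0, a_0)` is drawn from `μ`. -/
noncomputable def rolloutFrom (M : MDP O A) (π : Kernel O A) [IsMarkovKernel π]
    (μ : Measure (O × A)) : Measure (ℕ → O × A) :=
  M.rolloutFromPair π ∘ₘ μ

theorem rolloutFrom_dirac (M : MDP O A) (π : Kernel O A) [IsMarkovKernel π] (x : O × A) :
    M.rolloutFrom π (Measure.dirac x) = M.rolloutFromPair π x :=
  Measure.dirac_bind (Kernel.measurable _) x

theorem rolloutFromObs_apply (M : MDP O A) (π : Kernel O A) [IsMarkovKernel π] (o : O) :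
    M.rolloutFromObs π o = M.rolloutFrom π ((π o).map fun a => (o, a)) := by
  rw [rolloutFromObs, Kernel.comp_apply, rolloutFrom, Kernel.prod_apply, Kernel.id_apply,
    Measure.dirac_prod]

theorem rollout_eq (M : MDP O A) (π : Kernel O A) [IsMarkovKernel π] :
    M.rollout π = M.rolloutFrom π (M.init ⊗ₘ π) := by
  rw [rollout, rolloutFromObs, rolloutFrom, Measure.compProd_eq_comp_prod, Measure.comp_assoc]

theorem map_eval_rolloutFrom (M : MDP O A) (π : Kernel O A) [IsMarkovKernel π]
    (μ : Measure (O × A)) (t : ℕ) :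
    (M.rolloutFrom π μ).map (fun ω => ω t) = M.timeLaw π t ∘ₘ μ := by
  rw [rolloutFrom, Measure.map_comp _ _ (measurable_pi_apply t)]
  rfl

/-- The discounted occupancy measure `∑_t γ^t P((o_t, a_t) ∈ ·)` when `(o_0, a_0)` is drawn
from `μ`. -/
noncomputable def occupancy (M : MDP O A) (π : Kernel O A) [IsMarkovKernel π]
    (μ : Measure (O × A)) : Measure (O × A) :=
  Measure.sum fun t => ENNReal.ofReal (M.γ ^ t) • (M.timeLaw π t ∘ₘ μ)

/-- First-step decomposition, the source of the Bellman equation for `qValue`. -/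
theorem occupancy_eq_add_comp_step (M : MDP O A) (π : Kernel O A) [IsMarkovKernel π]
    (μ : Measure (O × A)) :
    M.occupancy π μ = μ + ENNReal.ofReal M.γ • M.occupancy π (M.step π ∘ₘ μ) := by
  ext s hs
  simp only [occupancy, Measure.add_apply, Measure.smul_apply, Measure.sum_apply _ hs, smul_eq_mul]
  rw [tsum_eq_zero_add' ENNReal.summable, ← ENNReal.tsum_mul_left, timeLaw_zero, pow_zero,
    ENNReal.ofReal_one, one_mul, Measure.id_comp]
  congr 1
  refine tsum_congr fun t => ?_
  rw [timeLaw_succ', Measure.comp_assoc, pow_succ', ENNReal.ofReal_mul M.γ_nonneg, mul_assoc]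

/-- Last-step decomposition: discounted flow balance, used for moment bounds and for the performance
difference lemma. -/
theorem occupancy_eq_add_step_comp (M : MDP O A) (π : Kernel O A) [IsMarkovKernel π]
    (μ : Measure (O × A)) :
    M.occupancy π μ = μ + ENNReal.ofReal M.γ • (M.step π ∘ₘ M.occupancy π μ) := by
  ext s hs
  simp only [occupancy, Measure.add_apply, Measure.smul_apply, smul_eq_mul]
  rw [Measure.bind_sum _ _ (Kernel.aemeasurable _), Measure.sum_apply _ hs, Measure.sum_apply _ hs,
    tsum_eq_zero_add' ENNReal.summable, ← ENNReal.tsum_mul_left, timeLaw_zero, pow_zero,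
    ENNReal.ofReal_one, one_smul,
    Measure.id_comp]
  congr 1
  refine tsum_congr fun t => ?_
  rw [timeLaw_succ, ← Measure.comp_assoc, Measure.comp_smul, pow_succ',
    ENNReal.ofReal_mul M.γ_nonneg, mul_smul, Measure.smul_apply, smul_eq_mul]

theorem lintegral_rolloutFrom_eval (M : MDP O A) (π : Kernel O A) [IsMarkovKernel π]
    (μ : Measure (O × A)) (t : ℕ) {f : O × A → ℝ≥0∞} (hf : Measurable f) :
    ∫⁻ ω, f (ω t) ∂M.rolloutFrom π μ = ∫⁻ x, f x ∂(M.timeLaw π t ∘ₘ μ) := by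
  rw [← map_eval_rolloutFrom, lintegral_map hf (measurable_pi_apply t)]

theorem measurable_absReward (M : MDP O A) : Measurable fun x : O × A => ‖M.reward x.1 x.2‖ₑ :=
  M.measurable_reward.enorm

theorem tsum_lintegral_enorm (M : MDP O A) (π : Kernel O A) [IsMarkovKernel π]
    (μ : Measure (O × A)) :
    ∑' t, ∫⁻ ω, ‖M.γ ^ t * M.reward (ω t).1 (ω t).2‖ₑ ∂M.rolloutFrom π μ =
      ∫⁻ x, ‖M.reward x.1 x.2‖ₑ ∂M.occupancy π μ := by
  rw [occupancy, lintegral_sum_measure]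
  refine tsum_congr fun t => ?_
  rw [lintegral_smul_measure, ← lintegral_rolloutFrom_eval _ _ _ _ M.measurable_absReward,
    smul_eq_mul, ← lintegral_const_mul]
  · refine lintegral_congr fun ω => ?_
    rw [enorm_mul, Real.enorm_of_nonneg (pow_nonneg M.γ_nonneg _)]
  · exact M.measurable_absReward.comp (measurable_pi_apply t)

theorem measurable_discountedTerm (M : MDP O A) (t : ℕ) :
    Measurable fun ω : ℕ → O × A => M.γ ^ t * M.reward (ω t).1 (ω t).2 :=
  (M.measurable_reward.comp (measurable_pi_apply t)).const_mul _

theorem lintegral_absReturn (M : MDP O A) (π : Kernel O A) [IsMarkovKernel π]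
    (μ : Measure (O × A)) :
    ∫⁻ ω, M.absReturn ω ∂M.rolloutFrom π μ = ∫⁻ x, ‖M.reward x.1 x.2‖ₑ ∂M.occupancy π μ := by
  unfold absReturn
  rw [lintegral_tsum fun t => (M.measurable_discountedTerm t).enorm.aemeasurable,
    tsum_lintegral_enorm]

theorem integrable_discountedReturn (M : MDP O A) (π : Kernel O A) [IsMarkovKernel π]
    {μ : Measure (O × A)}
    (h : Integrable (fun x : O × A => M.reward x.1 x.2) (M.occupancy π μ)) :
    Integrable M.discountedReturn (M.rolloutFrom π μ) := by
  refine ⟨(Measurable.tsum fun t => M.measurable_discountedTerm t).aestronglyMeasurable, ?_⟩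
  refine lt_of_le_of_lt (lintegral_mono fun ω => ?_) ((M.lintegral_absReturn π μ).trans_lt h.2)
  exact enorm_tsum_le_tsum_enorm

/-- Fubini for the sum over time. It turns `J`, `value` and `qValue` into integrals of the reward
against occupancy measures. -/
theorem integral_discountedReturn (M : MDP O A) (π : Kernel O A) [IsMarkovKernel π]
    {μ : Measure (O × A)}
    (h : Integrable (fun x : O × A => M.reward x.1 x.2) (M.occupancy π μ)) :
    ∫ ω, M.discountedReturn ω ∂M.rolloutFrom π μ =
      ∫ x, M.reward x.1 x.2 ∂M.occupancy π μ := by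
  unfold discountedReturn
  rw [integral_tsum fun t => (M.measurable_discountedTerm t).aestronglyMeasurable]
  · rw [occupancy, integral_sum_measure h]
    refine tsum_congr fun t => ?_
    rw [integral_smul_measure, ENNReal.toReal_ofReal (pow_nonneg M.γ_nonneg _), smul_eq_mul,
      integral_const_mul, ← map_eval_rolloutFrom, integral_map]
    · exact (measurable_pi_apply t).aemeasurable
    · exact M.measurable_reward.aestronglyMeasurable
  · rw [tsum_lintegral_enorm]
    exact h.2.ne

theorem occupancy_univ (M : MDP O A) (π : Kernel O A) [IsMarkovKernel π]
    (μ : Measure (O × A)) [IsProbabilityMeasure μ] :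
    M.occupancy π μ Set.univ = ENNReal.ofReal (1 - M.γ)⁻¹ := by
  simp only [occupancy, Measure.sum_apply _ MeasurableSet.univ, Measure.smul_apply, smul_eq_mul,
    measure_univ, mul_one]
  rw [← ENNReal.ofReal_tsum_of_nonneg (fun t => pow_nonneg M.γ_nonneg t)
    (summable_geometric_of_lt_one M.γ_nonneg M.γ_lt_one),
    tsum_geometric_of_lt_one M.γ_nonneg M.γ_lt_one]

instance (M : MDP O A) (π : Kernel O A) [IsMarkovKernel π]
    (μ : Measure (O × A)) [IsProbabilityMeasure μ] : IsFiniteMeasure (M.occupancy π μ) :=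
  ⟨by rw [occupancy_univ]; exact ENNReal.ofReal_lt_top⟩

theorem lintegral_step (M : MDP O A) (π : Kernel O A) [IsMarkovKernel π] (x : O × A)
    {f : O × A → ℝ≥0∞} (hf : Measurable f) :
    ∫⁻ y, f y ∂M.step π x = ∫⁻ o, ∫⁻ a, f (o, a) ∂π o ∂M.next x := by
  rw [step, Kernel.lintegral_compProd _ _ _ hf]
  rfl

end MDP

/-! ### Value functions, the Bellman equation and the performance difference lemma. -/

namespace MDP

variable {O A : Type*} [MeasurableSpace O] [MeasurableSpace A]

theorem stronglyMeasurable_qValue (M : MDP O A) (π : Kernel O A) [IsMarkovKernel π] :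
    StronglyMeasurable fun x : O × A => M.qValue π x.1 x.2 :=
  StronglyMeasurable.integral_kernel
    (Measurable.tsum fun t => M.measurable_discountedTerm t).stronglyMeasurable

theorem stronglyMeasurable_value (M : MDP O A) (π : Kernel O A) [IsMarkovKernel π] :
    StronglyMeasurable (M.value π) :=
  StronglyMeasurable.integral_kernel
    (Measurable.tsum fun t => M.measurable_discountedTerm t).stronglyMeasurable

theorem stronglyMeasurable_advantage (M : MDP O A) (π : Kernel O A) [IsMarkovKernel π] :
    StronglyMeasurable fun x : O × A => M.advantage π x.1 x.2 :=
  (stronglyMeasurable_qValue M π).sub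
    ((stronglyMeasurable_value M π).comp_measurable measurable_fst)

/-- The weight `w` dominates the reward and has expectation at most `B` under the policy `π`,
whatever the observation. -/
structure DominatedBy (M : MDP O A) (π : Kernel O A) (w : A → ℝ≥0) (B : ℝ≥0) : Prop where
  measurable : Measurable w
  reward_le : ∀ o a, ‖M.reward o a‖₊ ≤ w a
  lintegral_le : ∀ o, ∫⁻ a, w a ∂π o ≤ B

namespace DominatedBy

variable {M : MDP O A} {π : Kernel O A} {w : A → ℝ≥0} {B : ℝ≥0}

theorem measurable_snd (h : M.DominatedBy π w B) :
    Measurable fun x : O × A => (w x.2 : ℝ≥0∞) :=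
  (h.measurable.comp _root_.measurable_snd).coe_nnreal_ennreal

theorem integrable_of_bound (h : M.DominatedBy π w B) {ν : Measure (O × A)}
    [IsFiniteMeasure ν] (hν : ∫⁻ x, w x.2 ∂ν < ∞) {f : O × A → ℝ} (hf : StronglyMeasurable f)
    {c : ℝ} (hc : ∀ x, |f x| ≤ w x.2 + c) : Integrable f ν := by
  have hw : Integrable (fun x : O × A => (w x.2 : ℝ)) ν := by
    refine ⟨(h.measurable.comp _root_.measurable_snd).coe_nnreal_real.aestronglyMeasurable, ?_⟩
    simpa [HasFiniteIntegral] using hν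
  exact (hw.add (integrable_const c)).mono' hf.aestronglyMeasurable
    (Filter.Eventually.of_forall hc)

theorem lintegral_dirac_lt_top (h : M.DominatedBy π w B) (x : O × A) :
    ∫⁻ y, w y.2 ∂Measure.dirac x < ∞ := by
  rw [lintegral_dirac' _ h.measurable_snd]
  exact ENNReal.coe_lt_top

theorem lintegral_map_mk_le (h : M.DominatedBy π w B) (o : O) :
    ∫⁻ y, w y.2 ∂(π o).map (fun a => (o, a)) ≤ B := by
  rw [lintegral_map h.measurable_snd measurable_prodMk_left]
  exact h.lintegral_le o

variable [IsMarkovKernel π]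

theorem lintegral_compProd_le (h : M.DominatedBy π w B) (μ : Measure O) [SFinite μ] :
    ∫⁻ x, w x.2 ∂(μ ⊗ₘ π) ≤ B * μ Set.univ := by
  rw [Measure.lintegral_compProd h.measurable_snd, ← lintegral_const]
  exact lintegral_mono fun o => h.lintegral_le o

theorem lintegral_step_le (h : M.DominatedBy π w B) (x : O × A) :
    ∫⁻ y, w y.2 ∂M.step π x ≤ B := by
  rw [lintegral_step _ _ _ h.measurable_snd]
  refine (lintegral_mono fun o => h.lintegral_le o).trans ?_
  simp

/-- Only the initial action is arbitrary, which costs the integral over `μ`. Every later action is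
drawn from `π` and costs at most `B`; by flow balance these have total mass at most `(1 - γ)⁻¹`,
after bounding the factor `γ` by 1. -/
theorem lintegral_occupancy_le (h : M.DominatedBy π w B) (μ : Measure (O × A))
    [IsProbabilityMeasure μ] :
    ∫⁻ x, w x.2 ∂M.occupancy π μ ≤ ∫⁻ x, w x.2 ∂μ + B * ENNReal.ofReal (1 - M.γ)⁻¹ := by
  rw [occupancy_eq_add_step_comp, lintegral_add_measure, lintegral_smul_measure,
    Measure.lintegral_bind (Kernel.aemeasurable _) h.measurable_snd.aemeasurable]
  gcongr
  calc _ ≤ 1 * ∫⁻ _, (B : ℝ≥0∞) ∂M.occupancy π μ := by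
        rw [smul_eq_mul]
        gcongr
        · exact ENNReal.ofReal_le_one.2 M.γ_lt_one.le
        · exact h.lintegral_step_le _
    _ = _ := by rw [lintegral_const, occupancy_univ, one_mul]

theorem lintegral_reward_le (h : M.DominatedBy π w B) (μ : Measure (O × A))
    [IsProbabilityMeasure μ] :
    ∫⁻ x, ‖M.reward x.1 x.2‖ₑ ∂M.occupancy π μ ≤
      ∫⁻ x, w x.2 ∂μ + B * ENNReal.ofReal (1 - M.γ)⁻¹ :=
  (lintegral_mono fun x : O × A => ENNReal.coe_le_coe.2 (h.reward_le x.1 x.2)).trans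
    (h.lintegral_occupancy_le μ)

theorem integrable_reward (h : M.DominatedBy π w B) {μ : Measure (O × A)}
    [IsProbabilityMeasure μ] (hμ : ∫⁻ x, w x.2 ∂μ < ∞) :
    Integrable (fun x : O × A => M.reward x.1 x.2) (M.occupancy π μ) :=
  ⟨M.measurable_reward.aestronglyMeasurable, (h.lintegral_reward_le μ).trans_lt
    (ENNReal.add_lt_top.2 ⟨hμ, ENNReal.mul_lt_top ENNReal.coe_lt_top ENNReal.ofReal_lt_top⟩)⟩

theorem lintegral_init_le (h : M.DominatedBy π w B) : ∫⁻ y, w y.2 ∂(M.init ⊗ₘ π) ≤ B := by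
  simpa using h.lintegral_compProd_le M.init

theorem qValue_eq_integral_occupancy (h : M.DominatedBy π w B) (o : O) (a : A) :
    M.qValue π o a = ∫ x, M.reward x.1 x.2 ∂M.occupancy π (Measure.dirac (o, a)) := by
  rw [qValue, ← rolloutFrom_dirac,
    integral_discountedReturn _ _ (h.integrable_reward (h.lintegral_dirac_lt_top _))]

theorem integral_occupancy_eq_integral_qValue (h : M.DominatedBy π w B) {μ : Measure (O × A)}
    [IsProbabilityMeasure μ] (hμ : ∫⁻ x, w x.2 ∂μ < ∞) :
    ∫ x, M.reward x.1 x.2 ∂M.occupancy π μ = ∫ x, M.qValue π x.1 x.2 ∂μ := by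
  have hi := h.integrable_reward hμ
  rw [← integral_discountedReturn _ _ hi]
  exact Measure.integral_comp_kernel (M.integrable_discountedReturn π hi)

theorem abs_integral_occupancy_le (h : M.DominatedBy π w B) {μ : Measure (O × A)}
    [IsProbabilityMeasure μ] {c : ℝ≥0} (hμ : ∫⁻ x, w x.2 ∂μ ≤ c) :
    |∫ x, M.reward x.1 x.2 ∂M.occupancy π μ| ≤ c + B * (1 - M.γ)⁻¹ := by
  have hγ : 0 ≤ (1 - M.γ)⁻¹ := inv_nonneg.2 (sub_nonneg.2 M.γ_lt_one.le)
  have h1 := (enorm_integral_le_lintegral_enorm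
    (fun x : O × A => M.reward x.1 x.2)).trans ((h.lintegral_reward_le μ).trans
      (add_le_add_left hμ (B * ENNReal.ofReal (1 - M.γ)⁻¹)))
  have h2 : (c : ℝ≥0∞) + B * ENNReal.ofReal (1 - M.γ)⁻¹ =
      ENNReal.ofReal (c + B * (1 - M.γ)⁻¹) := by
    rw [ENNReal.ofReal_add (by positivity) (by positivity), ENNReal.ofReal_mul (by positivity)]
    simp
  rw [h2, ← ofReal_norm, ENNReal.ofReal_le_ofReal_iff (by positivity)] at h1
  exact h1

theorem abs_qValue_le (h : M.DominatedBy π w B) (o : O) (a : A) :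
    |M.qValue π o a| ≤ w a + B * (1 - M.γ)⁻¹ := by
  rw [h.qValue_eq_integral_occupancy]
  refine h.abs_integral_occupancy_le ?_
  rw [lintegral_dirac' _ h.measurable_snd]

instance (o : O) : IsProbabilityMeasure ((π o).map fun a => (o, a)) :=
  Measure.isProbabilityMeasure_map (by fun_prop)

theorem value_eq_integral_occupancy (h : M.DominatedBy π w B) (o : O) :
    M.value π o = ∫ x, M.reward x.1 x.2 ∂M.occupancy π ((π o).map fun a => (o, a)) := by
  rw [value, rolloutFromObs_apply, integral_discountedReturn _ _
    (h.integrable_reward ((h.lintegral_map_mk_le o).trans_lt ENNReal.coe_lt_top))]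

theorem abs_value_le (h : M.DominatedBy π w B) (o : O) :
    |M.value π o| ≤ B + B * (1 - M.γ)⁻¹ := by
  rw [h.value_eq_integral_occupancy]
  exact h.abs_integral_occupancy_le (h.lintegral_map_mk_le o)

theorem abs_advantage_le (h : M.DominatedBy π w B) (o : O) (a : A) :
    |M.advantage π o a| ≤ w a + (B + 2 * (B * (1 - M.γ)⁻¹)) := by
  have h1 := h.abs_qValue_le o a
  have h2 := h.abs_value_le o
  have h3 := abs_sub (M.qValue π o a) (M.value π o)
  rw [advantage]
  linarith

theorem value_eq_integral_qValue (h : M.DominatedBy π w B) (o : O) :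
    M.value π o = ∫ a, M.qValue π o a ∂π o := by
  rw [h.value_eq_integral_occupancy, h.integral_occupancy_eq_integral_qValue
    ((h.lintegral_map_mk_le o).trans_lt ENNReal.coe_lt_top), integral_map (by fun_prop)
    (stronglyMeasurable_qValue M π).aestronglyMeasurable]

theorem J_eq_integral_occupancy (h : M.DominatedBy π w B) :
    M.J π = ∫ x, M.reward x.1 x.2 ∂M.occupancy π (M.init ⊗ₘ π) := by
  rw [J, rollout_eq, integral_discountedReturn _ _
    (h.integrable_reward (h.lintegral_init_le.trans_lt ENNReal.coe_lt_top))]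

theorem integrable_qValue (h : M.DominatedBy π w B) {ν : Measure (O × A)}
    [IsFiniteMeasure ν] (hν : ∫⁻ x, w x.2 ∂ν < ∞) :
    Integrable (fun x : O × A => M.qValue π x.1 x.2) ν :=
  h.integrable_of_bound hν (stronglyMeasurable_qValue M π) fun x => h.abs_qValue_le x.1 x.2

theorem J_eq_integral_value (h : M.DominatedBy π w B) :
    M.J π = ∫ o, M.value π o ∂M.init := by
  have hi := h.lintegral_init_le.trans_lt ENNReal.coe_lt_top
  rw [h.J_eq_integral_occupancy, h.integral_occupancy_eq_integral_qValue hi,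
    Measure.integral_compProd (h.integrable_qValue hi)]
  exact integral_congr_ae (Filter.Eventually.of_forall fun o =>
    (h.value_eq_integral_qValue o).symm)

/-- The Bellman equation, from the first-step decomposition of the occupancy measure started at a
Dirac mass. -/
theorem qValue_eq_reward_add (h : M.DominatedBy π w B) (o : O) (a : A) :
    M.qValue π o a = M.reward o a + M.γ * ∫ o', M.value π o' ∂M.next (o, a) := by
  have hs := (h.lintegral_step_le (o, a)).trans_lt ENNReal.coe_lt_top
  have hi := h.integrable_reward (h.lintegral_dirac_lt_top (o, a))
  have hm : StronglyMeasurable fun x : O × A => M.reward x.1 x.2 :=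
    M.measurable_reward.stronglyMeasurable
  rw [h.qValue_eq_integral_occupancy]
  rw [occupancy_eq_add_comp_step] at hi ⊢
  rw [Measure.dirac_bind (Kernel.measurable _)] at hi ⊢
  rw [integral_add_measure hi.left_of_add_measure hi.right_of_add_measure, integral_dirac' _ _ hm,
    integral_smul_measure, ENNReal.toReal_ofReal M.γ_nonneg, smul_eq_mul,
    h.integral_occupancy_eq_integral_qValue hs, step]
  congr 2
  rw [ProbabilityTheory.integral_compProd (h.integrable_qValue hs)]
  exact integral_congr_ae (Filter.Eventually.of_forall fun o =>
    (h.value_eq_integral_qValue o).symm)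

theorem integral_advantage_eq_zero (h : M.DominatedBy π w B) (o : O) :
    ∫ a, M.advantage π o a ∂π o = 0 := by
  have hq : Integrable (fun a => M.qValue π o a) (π o) := by
    have := h.integrable_qValue ((h.lintegral_map_mk_le o).trans_lt ENNReal.coe_lt_top)
    exact this.comp_measurable measurable_prodMk_left
  unfold advantage
  rw [integral_sub hq (integrable_const _), ← h.value_eq_integral_qValue]
  simp

end DominatedBy

variable {M : MDP O A}

/-- Given the observation, the action is a fresh draw from `π` at every time: at time 0 by the
choice of initial law, later because `π` is the last factor of `step`. -/
theorem timeLaw_comp_compProd (π : Kernel O A) [IsMarkovKernel π] (t : ℕ) (μ : Measure O)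
    [IsProbabilityMeasure μ] :
    M.timeLaw π t ∘ₘ (μ ⊗ₘ π) = (M.timeLaw π t ∘ₘ (μ ⊗ₘ π)).fst ⊗ₘ π := by
  cases t with
  | zero => rw [timeLaw_zero, Measure.id_comp, Measure.fst_compProd]
  | succ t =>
    rw [timeLaw_succ, ← Measure.comp_assoc]
    set ν := M.timeLaw π t ∘ₘ (μ ⊗ₘ π)
    have : M.step π ∘ₘ ν = (M.next ∘ₘ ν) ⊗ₘ π := by
      ext s hs
      rw [Measure.bind_apply hs (Kernel.aemeasurable _), Measure.compProd_apply hs,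
        Measure.lintegral_bind (Kernel.aemeasurable _)
          (Kernel.measurable_kernel_prodMk_left hs).aemeasurable]
      refine lintegral_congr fun x => ?_
      rw [step, Kernel.compProd_apply hs]
      rfl
    rw [this, Measure.fst_compProd]

theorem visitation_compProd (π : Kernel O A) [IsMarkovKernel π] :
    M.visitation π ⊗ₘ π = M.occupancy π (M.init ⊗ₘ π) := by
  have (t : ℕ) : (M.rollout π).map (fun ω => (ω t).1) =
      (M.timeLaw π t ∘ₘ (M.init ⊗ₘ π)).fst := by
    rw [← map_eval_rolloutFrom, rollout_eq, Measure.fst,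
      Measure.map_map _root_.measurable_fst (measurable_pi_apply t)]
    rfl
  unfold visitation occupancy
  rw [Measure.compProd_sum_left]
  congr 1
  ext1 t
  rw [Measure.compProd_smul_left, this, ← timeLaw_comp_compProd]

theorem visitation_univ (π : Kernel O A) [IsMarkovKernel π] :
    M.visitation π Set.univ = ENNReal.ofReal (1 - M.γ)⁻¹ := by
  have := M.occupancy_univ π (M.init ⊗ₘ π)
  rwa [← visitation_compProd, Measure.compProd_apply_univ] at this

/-- The performance difference lemma. -/
theorem performance_difference {π π' : Kernel O A} [IsMarkovKernel π] [IsMarkovKernel π']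
    {w : A → ℝ≥0} {B : ℝ≥0} (h : M.DominatedBy π w B) (h' : M.DominatedBy π' w B) :
    M.J π' - M.J π = ∫ x, M.advantage π x.1 x.2 ∂(M.visitation π' ⊗ₘ π') := by
  have hν := h'.lintegral_occupancy_le (M.init ⊗ₘ π')
  rw [h'.J_eq_integral_occupancy, h.J_eq_integral_value, visitation_compProd]
  have hflow := M.occupancy_eq_add_step_comp π' (M.init ⊗ₘ π')
  set ν := M.occupancy π' (M.init ⊗ₘ π') with hνdef
  have hfin : ∫⁻ x, w x.2 ∂ν < ∞ := hν.trans_lt (ENNReal.add_lt_top.2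
    ⟨h'.lintegral_init_le.trans_lt ENNReal.coe_lt_top,
      ENNReal.mul_lt_top ENNReal.coe_lt_top ENNReal.ofReal_lt_top⟩)
  have hVm : StronglyMeasurable fun x : O × A => M.value π x.1 :=
    (stronglyMeasurable_value M π).comp_measurable measurable_fst
  have hV (ρ : Measure (O × A)) [IsFiniteMeasure ρ] :
      Integrable (fun x : O × A => M.value π x.1) ρ :=
    (integrable_const (B + B * (1 - M.γ)⁻¹ : ℝ)).mono' hVm.aestronglyMeasurable
      (Filter.Eventually.of_forall fun x => h.abs_value_le x.1)
  have hr : Integrable (fun x : O × A => M.reward x.1 x.2) ν :=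
    h'.integrable_reward (h'.lintegral_init_le.trans_lt ENNReal.coe_lt_top)
  have hPV : StronglyMeasurable fun x : O × A => ∫ o', M.value π o' ∂M.next x :=
    StronglyMeasurable.integral_kernel (stronglyMeasurable_value M π)
  -- Flow balance for `π'` tested on the value function of `π`. The next line of attack, the Bellman
  -- equation for `π`, produces the same discounted term, so it cancels in the difference `qValue -
  -- value`.
  have hstep : ∫ x, M.value π x.1 ∂ν =
      ∫ o, M.value π o ∂M.init + M.γ * ∫ x, ∫ o', M.value π o' ∂M.next x ∂ν := by
    conv_lhs => rw [hflow]
    rw [integral_add_measure (hV _) ((hV _).smul_measure ENNReal.ofReal_ne_top),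
      integral_smul_measure, ENNReal.toReal_ofReal M.γ_nonneg, smul_eq_mul,
      Measure.integral_compProd (hV _), Measure.integral_comp_kernel (hV _)]
    congr 1
    · simp
    · congr 1
      refine integral_congr_ae (Filter.Eventually.of_forall fun x => ?_)
      simp only [step]
      rw [ProbabilityTheory.integral_compProd (by exact hV _)]
      simp
  have hq : ∫ x, M.qValue π x.1 x.2 ∂ν = ∫ x, M.reward x.1 x.2 ∂ν +
      M.γ * ∫ x, ∫ o', M.value π o' ∂M.next x ∂ν := by
    have hi : Integrable (fun x : O × A => M.γ * ∫ o', M.value π o' ∂M.next x) ν := by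
      -- By the Bellman equation this function is `qValue` minus the reward, both integrable.
      refine ((h.integrable_qValue hfin).sub hr).congr (Filter.Eventually.of_forall fun x => ?_)
      simp [h.qValue_eq_reward_add]
    rw [← integral_const_mul, ← integral_add hr hi]
    exact integral_congr_ae (Filter.Eventually.of_forall fun x => h.qValue_eq_reward_add x.1 x.2)
  unfold advantage
  rw [integral_sub (h.integrable_qValue hfin) (hV _), hq, hstep]
  ring

end MDP

/-! ### The density of an isotropic Gaussian. -/

namespace ProbabilityTheory

section IsotropicGaussian

variable {d : ℕ} {σ : ℝ}

/-- The density of the isotropic Gaussian law `N(μ, σ² I)` on `ℝ^d`. -/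
noncomputable def isotropicDensity (σ : ℝ) (μ x : EuclideanSpace ℝ (Fin d)) : ℝ :=
  (2 * Real.pi * σ ^ 2) ^ (-(d : ℝ) / 2) * Real.exp (-‖x - μ‖ ^ 2 / (2 * σ ^ 2))

theorem isotropicDensity_nonneg (σ : ℝ) (μ x : EuclideanSpace ℝ (Fin d)) :
    0 ≤ isotropicDensity σ μ x := by
  unfold isotropicDensity; positivity

theorem isotropicDensity_pos (hσ : 0 < σ) (μ x : EuclideanSpace ℝ (Fin d)) :
    0 < isotropicDensity σ μ x := by
  unfold isotropicDensity; positivity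

@[fun_prop]
theorem measurable_isotropicDensity (σ : ℝ) :
    Measurable fun p : EuclideanSpace ℝ (Fin d) × EuclideanSpace ℝ (Fin d) =>
      isotropicDensity σ p.1 p.2 := by
  unfold isotropicDensity; fun_prop

theorem integrable_isotropicDensity (hσ : 0 < σ) (μ : EuclideanSpace ℝ (Fin d)) :
    Integrable (isotropicDensity σ μ) := by
  have hb : 0 < ((1 / (2 * σ ^ 2) : ℝ) : ℂ).re := by
    rw [Complex.ofReal_re]; positivity
  have h := (GaussianFourier.integrable_cexp_neg_mul_sq_norm_add hb 0
    (0 : EuclideanSpace ℝ (Fin d))).norm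
  have h' : Integrable fun v : EuclideanSpace ℝ (Fin d) => Real.exp (-‖v‖ ^ 2 / (2 * σ ^ 2)) := by
    refine h.congr (Filter.Eventually.of_forall fun v => ?_)
    simp only [zero_mul, add_zero, Complex.norm_exp]
    congr 1
    norm_cast
    ring
  exact (h'.comp_sub_right μ).const_mul _

theorem charFun_isotropicDensity (hσ : 0 < σ) (μ t : EuclideanSpace ℝ (Fin d)) :
    ∫ x, (isotropicDensity σ μ x : ℂ) * Complex.exp (⟪x, t⟫ * Complex.I) =
      Complex.exp (⟪t, μ⟫ * Complex.I - σ ^ 2 * ‖t‖ ^ 2 / 2) := by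
  have hb : 0 < ((1 / (2 * σ ^ 2) : ℝ) : ℂ).re := by
    rw [Complex.ofReal_re]; positivity
  have h := GaussianFourier.integral_cexp_neg_mul_sq_norm_add hb Complex.I t
  rw [← integral_add_right_eq_self _ μ]
  have hσ' : (σ : ℂ) ≠ 0 := by exact_mod_cast hσ.ne'
  have hpos : (0 : ℝ) ≤ 2 * Real.pi * σ ^ 2 := by positivity
  have key (v : EuclideanSpace ℝ (Fin d)) :
      (isotropicDensity σ μ (v + μ) : ℂ) * Complex.exp (⟪v + μ, t⟫ * Complex.I) =
        (((2 * Real.pi * σ ^ 2) ^ (-(d : ℝ) / 2) : ℝ) : ℂ) * Complex.exp (⟪t, μ⟫ * Complex.I) *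
          Complex.exp (-((1 / (2 * σ ^ 2) : ℝ) : ℂ) * ‖v‖ ^ 2 + Complex.I * ⟪t, v⟫) := by
    rw [isotropicDensity, add_sub_cancel_right, inner_add_left, real_inner_comm v t,
      real_inner_comm μ t]
    generalize (2 * Real.pi * σ ^ 2) ^ (-(d : ℝ) / 2) = c
    push_cast
    rw [mul_assoc (c : ℂ), mul_assoc (c : ℂ), ← Complex.exp_add, ← Complex.exp_add]
    congr 2
    ring
  simp_rw [key]
  rw [integral_const_mul, h]
  -- The normalising constant cancels the factor `(π / b) ^ (d / 2)` of the Gaussian integral, with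
  -- `b = 1 / (2σ²)`.
  have hdet : ((2 * Real.pi * σ ^ 2 : ℝ) : ℂ) ^ (-(d : ℂ) / 2) *
      ((2 * Real.pi * σ ^ 2 : ℝ) : ℂ) ^ ((d : ℂ) / 2) = 1 := by
    rw [← Complex.cpow_add _ _ (by exact_mod_cast (by positivity : 2 * Real.pi * σ ^ 2 ≠ 0))]
    rw [neg_div, neg_add_cancel, Complex.cpow_zero]
  have hπ : (Real.pi : ℂ) / ((1 / (2 * σ ^ 2) : ℝ) : ℂ) = ((2 * Real.pi * σ ^ 2 : ℝ) : ℂ) := by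
    push_cast; field_simp
  rw [hπ, finrank_euclideanSpace_fin, Complex.ofReal_cpow hpos]
  rw [show (((-(d : ℝ) / 2 : ℝ)) : ℂ) = -(d : ℂ) / 2 by push_cast; rfl]
  rw [mul_mul_mul_comm, hdet, one_mul, ← Complex.exp_add, Complex.I_sq]
  congr 1
  push_cast
  field_simp
  ring

/-- `multivariateGaussian` is an affine image of the standard Gaussian, not given by a density; the
two finite measures agree because their characteristic functions do. -/
theorem multivariateGaussian_eq_withDensity (hσ : 0 < σ) (μ : EuclideanSpace ℝ (Fin d)) :
    multivariateGaussian μ (σ ^ 2 • (1 : Matrix (Fin d) (Fin d) ℝ)) =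
      volume.withDensity fun x => ENNReal.ofReal (isotropicDensity σ μ x) := by
  have hi := integrable_isotropicDensity hσ μ
  have hm : Measurable fun x => isotropicDensity σ μ x := by
    unfold isotropicDensity; fun_prop
  have : IsFiniteMeasure (volume.withDensity fun x => ENNReal.ofReal (isotropicDensity σ μ x)) :=
    isFiniteMeasure_withDensity_ofReal hi.2
  have hS : (σ ^ 2 • (1 : Matrix (Fin d) (Fin d) ℝ)).PosSemidef :=
    Matrix.PosSemidef.one.smul (sq_nonneg σ)
  have hq : (t : EuclideanSpace ℝ (Fin d)) → (t : Fin d → ℝ) ⬝ᵥ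
      (σ ^ 2 • (1 : Matrix (Fin d) (Fin d) ℝ)).mulVec t = σ ^ 2 * ‖t‖ ^ 2 := fun t => by
    rw [Matrix.smul_mulVec, Matrix.one_mulVec, dotProduct_smul, EuclideanSpace.real_norm_sq_eq,
      smul_eq_mul, dotProduct]
    simp_rw [sq]
  refine Measure.ext_of_charFun (funext fun t => ?_)
  have h1 := charFun_multivariateGaussian (μ := μ) hS t
  have h2 : charFun (volume.withDensity fun x => ENNReal.ofReal (isotropicDensity σ μ x)) t =
      ∫ x, (isotropicDensity σ μ x : ℂ) * Complex.exp (⟪x, t⟫ * Complex.I) := by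
    rw [charFun_apply, integral_withDensity_eq_integral_toReal_smul hm.ennreal_ofReal
        (Filter.Eventually.of_forall fun _ => ENNReal.ofReal_lt_top)]
    refine integral_congr_ae (Filter.Eventually.of_forall fun x => ?_)
    simp only [ENNReal.toReal_ofReal (isotropicDensity_nonneg σ μ _), Complex.real_smul]
  rw [h1, h2, charFun_isotropicDensity hσ, hq t]
  push_cast
  rfl

end IsotropicGaussian

end ProbabilityTheory

/-! ### The density of the denoising chain and its uniform envelope. -/

namespace VelocityField

variable {d : ℕ} {O : Type*} [MeasurableSpace O]

/-- The reference measure `N(0, I) ⊗ vol ⊗ ⋯ ⊗ vol` for the first `n + 1` states of a denoising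
chain. -/
noncomputable def refMeasure (d : ℕ) : (n : ℕ) → Measure (Fin (n + 1) → Act d)
  | 0 => (stdGaussian (Act d)).map fun a _ => a
  | n + 1 => ((refMeasure d n).prod volume).map fun p => Fin.snoc (α := fun _ => Act d) p.1 p.2

instance sFinite_refMeasure (d n : ℕ) : SFinite (refMeasure d n) := by
  induction n with
  | zero => unfold refMeasure; infer_instance
  | succ n ih => unfold refMeasure; infer_instance

theorem measurable_transitionDensity (u : VelocityField d O) (σ : ℝ) (K k : ℕ) :
    Measurable fun x : O × Act d × Act d => u.transitionDensity σ K k x.1 x.2.1 x.2.2 := by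
  have h := u.measurable_mean K k
  have h' : Measurable fun x : O × Act d × Act d => u.mean K k x.1 x.2.1 :=
    h.comp (measurable_fst.prodMk measurable_snd.fst)
  have := (measurable_isotropicDensity σ).comp (h'.prodMk measurable_snd.snd)
  exact this

theorem measurable_transitionDensity_right (u : VelocityField d O) (σ : ℝ) (K k : ℕ) (o : O)
    (a : Act d) : Measurable fun a' : Act d => u.transitionDensity σ K k o a a' := by
  have := (u.measurable_transitionDensity σ K k).comp
    ((measurable_prodMk_left (x := o)).comp (measurable_prodMk_left (x := a)))
  exact this

theorem transitionDensity_nonneg (u : VelocityField d O) (σ : ℝ) (K k : ℕ) (o : O)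
    (a a' : Act d) : 0 ≤ u.transitionDensity σ K k o a a' :=
  isotropicDensity_nonneg σ _ _

theorem transition_eq_withDensity (u : VelocityField d O) {σ : ℝ} (hσ : 0 < σ) (K k : ℕ) (o : O)
    (a : Act d) : u.transition σ K k (o, a) =
      volume.withDensity fun a' => ENNReal.ofReal (u.transitionDensity σ K k o a a') :=
  multivariateGaussian_eq_withDensity hσ _

/-- The density of the law of the first `n + 1` states with respect to `refMeasure`. -/
noncomputable def chainDensity (u : VelocityField d O) (σ : ℝ) (K n : ℕ) (o : O)
    (x : Fin (n + 1) → Act d) : ℝ :=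
  ∏ k : Fin n, u.transitionDensity σ K k o (x k.castSucc) (x k.succ)

theorem chainDensity_nonneg (u : VelocityField d O) (σ : ℝ) (K n : ℕ) (o : O)
    (x : Fin (n + 1) → Act d) : 0 ≤ u.chainDensity σ K n o x :=
  Finset.prod_nonneg fun _ _ => u.transitionDensity_nonneg _ _ _ _ _ _

theorem chainDensity_snoc (u : VelocityField d O) (σ : ℝ) (K n : ℕ) (o : O)
    (x : Fin (n + 1) → Act d) (a : Act d) :
    u.chainDensity σ K (n + 1) o (Fin.snoc (α := fun _ => Act d) x a) =
      u.chainDensity σ K n o x * u.transitionDensity σ K n o (x (Fin.last n)) a := by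
  rw [chainDensity, Fin.prod_univ_castSucc]
  congr 1
  · refine Finset.prod_congr rfl fun k _ => ?_
    rw [← Fin.castSucc_succ, Fin.snoc_castSucc (α := fun _ => Act d),
      Fin.snoc_castSucc (α := fun _ => Act d)]
    rfl
  · rw [Fin.succ_last, Fin.snoc_last (α := fun _ => Act d),
      Fin.snoc_castSucc (α := fun _ => Act d)]
    rfl

theorem measurable_chainDensity (u : VelocityField d O) (σ : ℝ) (K n : ℕ) :
    Measurable fun p : O × (Fin (n + 1) → Act d) => u.chainDensity σ K n p.1 p.2 := by
  refine Finset.measurable_prod _ fun k _ => ?_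
  have hk (i : Fin (n + 1)) : Measurable fun p : O × (Fin (n + 1) → Act d) => p.2 i := by
    fun_prop
  have := (u.measurable_transitionDensity σ K k).comp
    (measurable_fst.prodMk ((hk k.castSucc).prodMk (hk k.succ)))
  exact this

theorem measurable_chainDensity_right (u : VelocityField d O) (σ : ℝ) (K n : ℕ) (o : O) :
    Measurable fun x : Fin (n + 1) → Act d => u.chainDensity σ K n o x := by
  have := (u.measurable_chainDensity σ K n).comp (measurable_prodMk_left (x := o))
  exact this

/-- The law of the first state depends neither on `u` nor on `o`, so it stays in the reference
measure; each transition contributes one density factor. -/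
theorem chain_eq_withDensity (u : VelocityField d O) {σ : ℝ} (hσ : 0 < σ) (K n : ℕ) (o : O) :
    u.chain σ K n o =
      (refMeasure d n).withDensity fun x => ENNReal.ofReal (u.chainDensity σ K n o x) := by
  induction n with
  | zero => simp [chain, refMeasure, chainDensity]
  | succ n ih =>
    refine Measure.ext_of_lintegral _ fun f hf => ?_
    have hs : Measurable fun p : (Fin (n + 1) → Act d) × Act d =>
        (Fin.snoc (α := fun _ => Act d) p.1 p.2 : Fin (n + 2) → Act d) := measurable_snoc (n + 1)
    have hfs : Measurable fun p : (Fin (n + 1) → Act d) × Act d =>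
        f (Fin.snoc (α := fun _ => Act d) p.1 p.2) := hf.comp hs
    have hd := (u.measurable_chainDensity_right σ K (n + 1) o).ennreal_ofReal
    have hd' := (u.measurable_chainDensity_right σ K n o).ennreal_ofReal
    have hgs : Measurable fun p : (Fin (n + 1) → Act d) × Act d =>
        ((fun x => ENNReal.ofReal (u.chainDensity σ K (n + 1) o x)) * f)
          (Fin.snoc (α := fun _ => Act d) p.1 p.2) := (hd.mul hf).comp hs
    rw [chain, Kernel.map_apply _ hs, lintegral_map hf hs,
      Kernel.lintegral_compProd _ _ _ hfs, ih,
      lintegral_withDensity_eq_lintegral_mul _ hd hf, refMeasure, lintegral_map (hd.mul hf) hs,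
      lintegral_prod _ hgs.aemeasurable,
      lintegral_withDensity_eq_lintegral_mul _ hd']
    · refine lintegral_congr fun x => ?_
      have ht : Measurable fun a' =>
          ENNReal.ofReal (u.transitionDensity σ K n o (x (Fin.last n)) a') :=
        Measurable.ennreal_ofReal (u.measurable_transitionDensity_right σ K n o _)
      have hfx : Measurable fun a' : Act d => f (Fin.snoc (α := fun _ => Act d) x a') :=
        hfs.comp measurable_prodMk_left
      simp only [Pi.mul_apply, Kernel.comap_apply, u.transition_eq_withDensity hσ, chainDensity_snoc]
      rw [lintegral_withDensity_eq_lintegral_mul _ ht hfx, ← lintegral_const_mul _ (ht.mul hfx)]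
      refine lintegral_congr fun a' => ?_
      simp only [Pi.mul_apply]
      rw [ENNReal.ofReal_mul (u.chainDensity_nonneg _ _ _ _ _), mul_assoc]
    · refine Measurable.lintegral_kernel_prod_right' (κ := ((u.transition σ K n).comap
        (fun x : O × (Fin (n + 1) → Act d) => (x.1, x.2 (Fin.last n))) (by fun_prop)).comap
          (fun x => (o, x)) (by fun_prop)) hfs

/-- The weight `∏ (1 + ‖x_i‖)` of a denoising chain. -/
noncomputable def chainWeight {n : ℕ} (x : Fin n → Act d) : ℝ := ∏ i, (1 + ‖x i‖)

@[fun_prop]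
theorem measurable_chainWeight (n : ℕ) :
    Measurable fun x : Fin n → Act d => chainWeight x := by
  unfold chainWeight; fun_prop

theorem one_le_chainWeight {n : ℕ} (x : Fin n → Act d) : 1 ≤ chainWeight x :=
  (Finset.prod_le_prod (s := Finset.univ) (f := fun _ : Fin n => (1 : ℝ)) (by simp)
    (fun i _ => by simp : ∀ i ∈ Finset.univ, (1 : ℝ) ≤ 1 + ‖x i‖)).trans' (by simp)

theorem one_add_norm_le_chainWeight {n : ℕ} (x : Fin n → Act d) (i : Fin n) :
    1 + ‖x i‖ ≤ chainWeight x := by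
  rw [chainWeight, ← Finset.mul_prod_erase _ _ (Finset.mem_univ i)]
  refine le_mul_of_one_le_right (by positivity) ?_
  exact (Finset.prod_le_prod (s := Finset.univ.erase i) (f := fun _ : Fin n => (1 : ℝ)) (by simp)
    (fun i _ => by simp : ∀ j ∈ Finset.univ.erase i, (1 : ℝ) ≤ 1 + ‖x j‖)).trans' (by simp)

theorem chainWeight_snoc {n : ℕ} (x : Fin n → Act d) (a : Act d) :
    chainWeight (Fin.snoc (α := fun _ => Act d) x a : Fin (n + 1) → Act d) =
      chainWeight x * (1 + ‖a‖) := by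
  rw [chainWeight, Fin.prod_univ_castSucc]
  simp [chainWeight]

/-- With `s = ‖x - μ‖`, `1 + ‖x‖ ≤ (1 + s)(1 + ‖μ‖)`, and the Gaussian factor in `s` absorbs `(1 +
s) ^ N`. The constant is uniform in `μ`, so decay in `x` is paid for by polynomial growth in the
mean. -/
theorem isotropicDensity_le {σ : ℝ} (hσ : 0 < σ) (N : ℕ) :
    ∃ c : ℝ, 0 ≤ c ∧ ∀ μ x : Act d,
      isotropicDensity σ μ x ≤ c * (1 + ‖μ‖) ^ N * ((1 + ‖x‖) ^ N)⁻¹ := by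
  refine ⟨(2 * Real.pi * σ ^ 2) ^ (-(d : ℝ) / 2) * (N.factorial * Real.exp (1 + σ ^ 2 / 2)),
    by positivity, fun μ x => ?_⟩
  have h1 : 1 + ‖x‖ ≤ (1 + ‖x - μ‖) * (1 + ‖μ‖) := by
    have := norm_add_le (x - μ) μ
    rw [sub_add_cancel] at this
    nlinarith [norm_nonneg (x - μ), norm_nonneg μ]
  set s := ‖x - μ‖ with hs
  have hs0 : 0 ≤ s := norm_nonneg _
  have h2 : (1 + s) ^ N ≤ N.factorial * Real.exp (1 + s) := by
    have := Real.pow_div_factorial_le_exp (1 + s) (by positivity) N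
    rwa [div_le_iff₀' (by positivity)] at this
  -- Complete the square: `s - s² / (2σ²)` is at most `σ² / 2`, its value at `s = σ²`.
  have h3 : Real.exp (-s ^ 2 / (2 * σ ^ 2)) * Real.exp (1 + s) ≤ Real.exp (1 + σ ^ 2 / 2) := by
    rw [← Real.exp_add, Real.exp_le_exp]
    have : -s ^ 2 / (2 * σ ^ 2) + s - σ ^ 2 / 2 = -((s - σ ^ 2) ^ 2 / (2 * σ ^ 2)) := by
      field_simp; ring
    have : 0 ≤ (s - σ ^ 2) ^ 2 / (2 * σ ^ 2) := by positivity
    linarith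
  have h4 : Real.exp (-s ^ 2 / (2 * σ ^ 2)) * (1 + ‖x‖) ^ N ≤
      N.factorial * Real.exp (1 + σ ^ 2 / 2) * (1 + ‖μ‖) ^ N := by
    calc Real.exp (-s ^ 2 / (2 * σ ^ 2)) * (1 + ‖x‖) ^ N
        ≤ Real.exp (-s ^ 2 / (2 * σ ^ 2)) * ((1 + s) * (1 + ‖μ‖)) ^ N := by gcongr
      _ = Real.exp (-s ^ 2 / (2 * σ ^ 2)) * (1 + s) ^ N * (1 + ‖μ‖) ^ N := by
        rw [mul_pow, mul_assoc]
      _ ≤ Real.exp (-s ^ 2 / (2 * σ ^ 2)) * (N.factorial * Real.exp (1 + s)) *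
          (1 + ‖μ‖) ^ N := by gcongr
      _ = N.factorial * (Real.exp (-s ^ 2 / (2 * σ ^ 2)) * Real.exp (1 + s)) *
          (1 + ‖μ‖) ^ N := by ring
      _ ≤ _ := by gcongr
  rw [isotropicDensity, ← hs, ← div_eq_mul_inv, le_div_iff₀ (by positivity),
    mul_assoc _ (Real.exp _), mul_assoc _ _ ((1 + ‖μ‖) ^ N)]
  exact mul_le_mul_of_nonneg_left h4 (by positivity)

/-- The velocity field `u` is bounded by `C (1 + ‖a‖)^m` at the times of the `K`-step chain. -/
def PolyBound (u : VelocityField d O) (K : ℕ) (C : ℝ) (m : ℕ) : Prop :=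
  ∀ k < K, ∀ (a : Act d) (o : O),
    ‖u.toFun a (flowTime K (k + 1)) (flowTime K k) o‖ ≤ C * (1 + ‖a‖) ^ m

theorem abs_flowTime_sub_le (K k : ℕ) : |flowTime K k - flowTime K (k + 1)| ≤ 1 := by
  have : flowTime K k - flowTime K (k + 1) = 1 / (K : ℝ) := by
    simp only [flowTime]; push_cast; ring
  rw [this, abs_of_nonneg (by positivity)]
  -- For `K = 0` the quotient `1 / K` is 0.
  rcases K.eq_zero_or_pos with rfl | hK
  · simp
  · rw [div_le_one (by exact_mod_cast hK)]
    exact_mod_cast hK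

theorem PolyBound.one_add_norm_mean_le {u : VelocityField d O} {K : ℕ} {C : ℝ} {m : ℕ}
    (h : u.PolyBound K C m) (hC : 0 ≤ C) {k : ℕ} (hk : k < K) (o : O) (a : Act d) :
    1 + ‖u.mean K k o a‖ ≤ (1 + C) * (1 + ‖a‖) ^ (m + 1) := by
  have h1 : ‖u.mean K k o a‖ ≤ ‖a‖ + C * (1 + ‖a‖) ^ m := by
    refine (norm_sub_le _ _).trans ?_
    rw [norm_smul, Real.norm_eq_abs]
    have := mul_le_mul (abs_flowTime_sub_le K k) (h k hk a o) (norm_nonneg _) zero_le_one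
    linarith
  have h2 : (1 : ℝ) + ‖a‖ ≤ (1 + ‖a‖) ^ (m + 1) :=
    le_self_pow₀ (by simp) (Nat.succ_ne_zero m)
  have h3 : (1 + ‖a‖) ^ m ≤ (1 + ‖a‖) ^ (m + 1) :=
    pow_le_pow_right₀ (by simp) (Nat.le_succ m)
  nlinarith

/-- The envelope is chosen before `u` and `o`, so it serves all nearby parameters at once. The
moment order `j` is generalised in the induction, because bounding the last transition costs a
higher power of the weight of the earlier states. -/
theorem exists_chainDensity_le {σ : ℝ} (hσ : 0 < σ) (K : ℕ) {C : ℝ} (hC : 0 ≤ C) (m : ℕ)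
    (O : Type*) [MeasurableSpace O] (n : ℕ) (hn : n ≤ K) (j : ℕ) :
    ∃ b : (Fin (n + 1) → Act d) → ℝ, Measurable b ∧ (∀ x, 0 ≤ b x) ∧
      Integrable (fun x => b x * chainWeight x ^ j) (refMeasure d n) ∧
      ∀ u : VelocityField d O, u.PolyBound K C m → ∀ o x, u.chainDensity σ K n o x ≤ b x := by
  induction n generalizing j with
  | zero =>
    refine ⟨fun _ => 1, measurable_const, fun _ => zero_le_one, ?_, fun u _ o x => by
      simp [chainDensity]⟩
    have h1 : MemLp (fun a : Act d => a) j (stdGaussian (Act d)) :=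
      IsGaussian.memLp_id (stdGaussian (Act d)) j (by simp)
    have h2 : MemLp (fun a : Act d => 1 + ‖a‖) j (stdGaussian (Act d)) :=
      (memLp_const (1 : ℝ)).add h1.norm
    have h3 : Integrable (fun a : Act d => ‖1 + ‖a‖‖ ^ j) (stdGaussian (Act d)) :=
      h2.integrable_norm_pow'
    have hm : Measurable fun (a : Act d) (_ : Fin (0 + 1)) => a := by fun_prop
    have hW : Measurable fun x : Fin (0 + 1) → Act d => 1 * chainWeight x ^ j := by fun_prop
    have hi : Integrable ((fun x : Fin (0 + 1) → Act d => 1 * chainWeight x ^ j) ∘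
        fun (a : Act d) (_ : Fin (0 + 1)) => a) (stdGaussian (Act d)) := by
      refine h3.congr (Filter.Eventually.of_forall fun a => ?_)
      simp [chainWeight, abs_of_nonneg (by positivity : 0 ≤ 1 + ‖a‖)]
    exact (integrable_map_measure hW.aestronglyMeasurable hm.aemeasurable).2 hi
  | succ n ih =>
    obtain ⟨c, hc0, hc⟩ := isotropicDensity_le (d := d) hσ (j + d + 1)
    -- The last state needs `j` powers for its own weight and `d + 1` more for integrability on
    -- `ℝ^d`. Its mean grows like the power `m + 1` of the previous state, hence the order `j + (m +
    -- 1) * N` requested below.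
    set N := j + d + 1 with hN
    obtain ⟨b, hbm, hb0, hbi, hb⟩ := ih (by lia) (j + (m + 1) * N)
    have hinit : Measurable fun y : Fin (n + 2) → Act d => (fun i : Fin (n + 1) => y i.castSucc) :=
      by fun_prop
    have hs : Measurable fun p : (Fin (n + 1) → Act d) × Act d =>
        (Fin.snoc (α := fun _ => Act d) p.1 p.2 : Fin (n + 2) → Act d) := measurable_snoc (n + 1)
    refine ⟨fun y => b (fun i => y i.castSucc) *
      (c * ((1 + C) * (1 + ‖y (Fin.last n).castSucc‖) ^ (m + 1)) ^ N *
      ((1 + ‖y (Fin.last (n + 1))‖) ^ N)⁻¹), ?_, ?_, ?_, ?_⟩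
    · have := hbm.comp hinit
      fun_prop
    · intro y
      have := hb0 (fun i => y i.castSucc)
      positivity
    · refine (integrable_map_measure ?_ hs.aemeasurable).2 ?_
      · have := hbm.comp hinit
        exact Measurable.aestronglyMeasurable (by fun_prop)
      · have h1 : Integrable (fun x : Fin (n + 1) → Act d => b x * chainWeight x ^ j *
            (c * ((1 + C) * (1 + ‖x (Fin.last n)‖) ^ (m + 1)) ^ N)) (refMeasure d n) := by
          refine (hbi.const_mul (c * (1 + C) ^ N)).mono' (by fun_prop)
            (Filter.Eventually.of_forall fun x => ?_)
          have hW := one_le_chainWeight x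
          rw [Real.norm_of_nonneg (by have := hb0 x; positivity)]
          have := one_add_norm_le_chainWeight x (Fin.last n)
          have hb := hb0 x
          calc _ ≤ b x * chainWeight x ^ j * (c * ((1 + C) * chainWeight x ^ (m + 1)) ^ N) := by
                gcongr
            _ = _ := by rw [mul_pow, ← pow_mul, pow_add]; ring
        have h2 : Integrable (fun a : Act d => (1 + ‖a‖) ^ j * ((1 + ‖a‖) ^ N)⁻¹) := by
          have := integrable_one_add_norm (E := Act d) (μ := volume) (r := d + 1) (by simp)
          refine this.congr (Filter.Eventually.of_forall fun a => ?_)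
          have ha : (0 : ℝ) < 1 + ‖a‖ := by positivity
          simp only
          rw [Real.rpow_neg ha.le, hN, show j + d + 1 = j + (d + 1) by ring, pow_add,
            mul_inv, mul_inv_cancel_left₀ (by positivity)]
          norm_cast
        refine (h1.mul_prod h2).congr (Filter.Eventually.of_forall fun p => ?_)
        simp only [Function.comp_apply, chainWeight_snoc, Fin.snoc_castSucc, Fin.snoc_last,
          mul_pow _ _ j]
        generalize ((1 + C) * (1 + ‖p.1 (Fin.last n)‖) ^ (m + 1)) ^ N = y
        ring
    · intro u hu o x
      have hx : x = (Fin.snoc (α := fun _ => Act d) (Fin.init x) (x (Fin.last (n + 1))) :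
        Fin (n + 2) → Act d) := (Fin.snoc_init_self x).symm
      have h1 : u.chainDensity σ K (n + 1) o x = u.chainDensity σ K n o (fun i => x i.castSucc) *
          u.transitionDensity σ K n o (x (Fin.last n).castSucc) (x (Fin.last (n + 1))) := by
        conv_lhs => rw [hx]
        rw [chainDensity_snoc]
        rfl
      rw [h1]
      refine mul_le_mul (hb u hu o _) ((hc _ _).trans ?_) (u.transitionDensity_nonneg _ _ _ _ _ _)
        (hb0 _)
      have := hu.one_add_norm_mean_le hC (by lia : n < K) o (x (Fin.last n).castSucc)
      gcongr

end VelocityField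

/-! ### The score of the denoising chain. -/

theorem measurable_gradient_of_measurable {α : Type*} [MeasurableSpace α] {p : ℕ}
    {f : EuclideanSpace ℝ (Fin p) → α → ℝ} {θ : EuclideanSpace ℝ (Fin p)}
    (hf : ∀ ϑ, Measurable (f ϑ)) (hd : ∀ x, DifferentiableAt ℝ (fun ϑ => f ϑ x) θ) :
    Measurable fun x => gradient (fun ϑ => f ϑ x) θ := by
  have hv (v : EuclideanSpace ℝ (Fin p)) :
      Measurable fun x => ⟪v, gradient (fun ϑ => f ϑ x) θ⟫ := by
    have hc : Filter.Tendsto (fun n : ℕ => ‖(n : ℝ)‖) Filter.atTop Filter.atTop := by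
      simpa using tendsto_natCast_atTop_atTop (R := ℝ)
    -- Each directional derivative is a pointwise limit of measurable difference quotients with
    -- increments `v / n`; the coordinates of the gradient suffice.
    refine measurable_of_tendsto_metrizable (f := fun (n : ℕ) x =>
      (n : ℝ) • (f (θ + (n : ℝ)⁻¹ • v) x - f θ x)) (fun n => ?_) ?_
    · have := ((hf (θ + (n : ℝ)⁻¹ • v)).sub (hf θ)).const_smul (n : ℝ)
      exact this
    rw [tendsto_pi_nhds]
    intro x
    have := (hd x).hasGradientAt.hasFDerivAt.lim v hc
    rwa [InnerProductSpace.toDual_apply_apply, real_inner_comm] at this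
  have h : (fun x => gradient (fun ϑ => f ϑ x) θ) = fun x =>
      ∑ i, ⟪EuclideanSpace.basisFun (Fin p) ℝ i, gradient (fun ϑ => f ϑ x) θ⟫ •
        EuclideanSpace.basisFun (Fin p) ℝ i := by
    funext x
    exact ((EuclideanSpace.basisFun (Fin p) ℝ).sum_repr' _).symm
  rw [h]
  exact Finset.measurable_fun_sum _ fun i _ => (hv _).smul_const _

namespace ProbabilityTheory

theorem hasFDerivAt_log_isotropicDensity {d : ℕ} {E : Type*} [NormedAddCommGroup E]
    [NormedSpace ℝ E] {σ : ℝ} (hσ : 0 < σ) (x : EuclideanSpace ℝ (Fin d))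
    {μ : E → EuclideanSpace ℝ (Fin d)} {μ' : E →L[ℝ] EuclideanSpace ℝ (Fin d)} {θ : E}
    (h : HasFDerivAt μ μ' θ) :
    HasFDerivAt (fun ϑ => Real.log (isotropicDensity σ (μ ϑ) x))
      ((σ ^ 2)⁻¹ • (innerSL ℝ (x - μ θ)).comp μ') θ := by
  have hlog : (fun ϑ => Real.log (isotropicDensity σ (μ ϑ) x)) = fun ϑ =>
      Real.log ((2 * Real.pi * σ ^ 2) ^ (-(d : ℝ) / 2)) + (-(2 * σ ^ 2)⁻¹) * ‖x - μ ϑ‖ ^ 2 := by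
    funext ϑ
    rw [isotropicDensity, Real.log_mul (by positivity) (Real.exp_ne_zero _), Real.log_exp]
    ring
  rw [hlog]
  have := ((h.const_sub x).norm_sq.const_mul (-(2 * σ ^ 2)⁻¹)).const_add
    (Real.log ((2 * Real.pi * σ ^ 2) ^ (-(d : ℝ) / 2)))
  refine this.congr_fderiv ?_
  ext v
  simp
  field_simp
  ring

end ProbabilityTheory

namespace VelocityField

variable {d p : ℕ} {O : Type*} [MeasurableSpace O]

/-- The log-density of the transitions of the denoising chain `x`, as a function of the
parameter. -/
noncomputable def logChainDensity (u : EuclideanSpace ℝ (Fin p) → VelocityField d O) (σ : ℝ)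
    (K : ℕ) (o : O) (x : Fin (K + 1) → Act d) (ϑ : EuclideanSpace ℝ (Fin p)) : ℝ :=
  ∑ k : Fin K, Real.log ((u ϑ).transitionDensity σ K k o (x k.castSucc) (x k.succ))

theorem exp_logChainDensity (u : EuclideanSpace ℝ (Fin p) → VelocityField d O) {σ : ℝ}
    (hσ : 0 < σ) (K : ℕ) (o : O) (x : Fin (K + 1) → Act d) (ϑ : EuclideanSpace ℝ (Fin p)) :
    Real.exp (logChainDensity u σ K o x ϑ) = (u ϑ).chainDensity σ K K o x := by
  rw [logChainDensity, Real.exp_sum, chainDensity]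
  exact Finset.prod_congr rfl fun k _ => Real.exp_log (isotropicDensity_pos hσ _ _)

theorem measurable_logChainDensity (u : EuclideanSpace ℝ (Fin p) → VelocityField d O) {σ : ℝ}
    (hσ : 0 < σ) (K : ℕ) (ϑ : EuclideanSpace ℝ (Fin p)) :
    Measurable fun y : O × (Fin (K + 1) → Act d) => logChainDensity u σ K y.1 y.2 ϑ := by
  have : (fun y : O × (Fin (K + 1) → Act d) => logChainDensity u σ K y.1 y.2 ϑ) =
      fun y => Real.log ((u ϑ).chainDensity σ K K y.1 y.2) := by
    funext y
    rw [← exp_logChainDensity u hσ, Real.log_exp]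
  rw [this]
  exact ((u ϑ).measurable_chainDensity σ K K).log

/-- At the parameter `θ`, the velocity field is differentiable in the parameter, and it and its
derivative are bounded by `C (1 + ‖a‖)^m`, at the times of the `K`-step chain. -/
structure SmoothBound (u : EuclideanSpace ℝ (Fin p) → VelocityField d O) (K : ℕ) (C : ℝ) (m : ℕ)
    (θ : EuclideanSpace ℝ (Fin p)) : Prop where
  polyBound : (u θ).PolyBound K C m
  differentiableAt : ∀ k < K, ∀ (a : Act d) (o : O), DifferentiableAt ℝ
    (fun ϑ => (u ϑ).toFun a (flowTime K (k + 1)) (flowTime K k) o) θ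
  norm_fderiv_le : ∀ k < K, ∀ (a : Act d) (o : O),
    ‖fderiv ℝ (fun ϑ => (u ϑ).toFun a (flowTime K (k + 1)) (flowTime K k) o) θ‖
      ≤ C * (1 + ‖a‖) ^ m

variable {u : EuclideanSpace ℝ (Fin p) → VelocityField d O} {K : ℕ} {C : ℝ} {m : ℕ}
  {θ : EuclideanSpace ℝ (Fin p)}

/-- The derivative is `σ⁻² ⟨x - μ, dμ ·⟩`. The residual `x - μ` contributes the power `m + 2` of the
weight and the derivative of the mean the power `m`, whence `2 * m + 2`. -/
theorem SmoothBound.exists_hasFDerivAt_log (h : SmoothBound u K C m θ) (hC : 0 ≤ C) {σ : ℝ}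
    (hσ : 0 < σ) (o : O) (x : Fin (K + 1) → Act d) (k : Fin K) :
    ∃ f' : EuclideanSpace ℝ (Fin p) →L[ℝ] ℝ,
      HasFDerivAt (fun ϑ => Real.log ((u ϑ).transitionDensity σ K k o (x k.castSucc) (x k.succ)))
        f' θ ∧ ‖f'‖ ≤ (σ ^ 2)⁻¹ * (1 + C) * C * chainWeight x ^ (2 * m + 2) := by
  have hu := (h.differentiableAt k k.2 (x k.castSucc) o).hasFDerivAt
  have hmean := (hu.const_smul (flowTime K k - flowTime K (k + 1))).const_sub (x k.castSucc)
  refine ⟨_, hasFDerivAt_log_isotropicDensity hσ (x k.succ) hmean, ?_⟩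
  have hW := one_le_chainWeight x
  have h1 := h.polyBound.one_add_norm_mean_le hC k.2 o (x k.castSucc)
  have h2 := one_add_norm_le_chainWeight x k.castSucc
  have h3 := one_add_norm_le_chainWeight x k.succ
  have h4 : ‖x k.succ - (u θ).mean K k o (x k.castSucc)‖ ≤
      (1 + C) * chainWeight x ^ (m + 2) := by
    have h5 : ‖x k.succ - (u θ).mean K k o (x k.castSucc)‖ ≤
        (1 + ‖x k.succ‖) * (1 + ‖(u θ).mean K k o (x k.castSucc)‖) := by
      have := norm_sub_le (x k.succ) ((u θ).mean K k o (x k.castSucc))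
      nlinarith [norm_nonneg (x k.succ), norm_nonneg ((u θ).mean K k o (x k.castSucc))]
    calc _ ≤ _ := h5
      _ ≤ chainWeight x * ((1 + C) * chainWeight x ^ (m + 1)) := by
        gcongr
        exact h1.trans (by gcongr)
      _ = _ := by ring
  have h6 := h.norm_fderiv_le k k.2 (x k.castSucc) o
  rw [norm_smul, Real.norm_of_nonneg (by positivity)]
  have h7 : C * (1 + ‖x k.castSucc‖) ^ m ≤ C * chainWeight x ^ m := by gcongr
  refine (mul_le_mul_of_nonneg_left (ContinuousLinearMap.opNorm_comp_le _ _)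
    (by positivity)).trans ?_
  rw [innerSL_apply_norm, norm_neg, norm_smul, Real.norm_eq_abs]
  have h8 : |flowTime K k - flowTime K (k + 1)| * ‖fderiv ℝ (fun ϑ => (u ϑ).toFun (x k.castSucc)
      (flowTime K (k + 1)) (flowTime K k) o) θ‖ ≤ 1 * (C * chainWeight x ^ m) :=
    mul_le_mul (abs_flowTime_sub_le K k) (h6.trans h7) (norm_nonneg _) zero_le_one
  calc _ ≤ (σ ^ 2)⁻¹ * (((1 + C) * chainWeight x ^ (m + 2)) * (1 * (C * chainWeight x ^ m))) := by
        refine mul_le_mul_of_nonneg_left (mul_le_mul h4 h8 (by positivity) (by positivity))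
          (by positivity)
    _ = _ := by ring

theorem SmoothBound.logChainDensity (h : SmoothBound u K C m θ) (hC : 0 ≤ C) {σ : ℝ}
    (hσ : 0 < σ) (o : O) (x : Fin (K + 1) → Act d) :
    DifferentiableAt ℝ (logChainDensity u σ K o x) θ ∧
      ‖gradient (VelocityField.logChainDensity u σ K o x) θ‖ ≤
        K * ((σ ^ 2)⁻¹ * (1 + C) * C) * chainWeight x ^ (2 * m + 2) := by
  choose f' hf' hn using h.exists_hasFDerivAt_log hC hσ o x
  have hs : HasFDerivAt (VelocityField.logChainDensity u σ K o x) (∑ k, f' k) θ :=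
    HasFDerivAt.fun_sum fun k _ => hf' k
  refine ⟨hs.differentiableAt, ?_⟩
  rw [gradient, LinearIsometryEquiv.norm_map, hs.fderiv]
  refine (norm_sum_le_of_le _ fun k _ => hn k).trans ?_
  simp [mul_assoc]

/-- The log-derivative identity `∇p = p ∇ log p`, obtained by differentiating `exp` of the
log-density. -/
theorem SmoothBound.hasGradientAt_chainDensity (h : SmoothBound u K C m θ) (hC : 0 ≤ C) {σ : ℝ}
    (hσ : 0 < σ) (o : O) (x : Fin (K + 1) → Act d) :
    HasGradientAt (fun ϑ => (u ϑ).chainDensity σ K K o x)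
      ((u θ).chainDensity σ K K o x • gradient (VelocityField.logChainDensity u σ K o x) θ) θ := by
  have := (h.logChainDensity hC hσ o x).1.hasGradientAt.hasFDerivAt.exp
  simp_rw [exp_logChainDensity u hσ] at this
  rw [hasGradientAt_iff_hasFDerivAt, map_smul]
  exact this

end VelocityField

/-! ### Dominated differentiation of chain expectations. -/

namespace VelocityField

variable {d p : ℕ} {O : Type*} [MeasurableSpace O]

theorem integral_chain (u : VelocityField d O) {σ : ℝ} (hσ : 0 < σ) (K : ℕ) (o : O)
    (f : (Fin (K + 1) → Act d) → ℝ) :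
    ∫ x, f x ∂u.chain σ K K o = ∫ x, u.chainDensity σ K K o x * f x ∂refMeasure d K := by
  rw [u.chain_eq_withDensity hσ, integral_withDensity_eq_integral_toReal_smul
    (u.measurable_chainDensity_right σ K K o).ennreal_ofReal
    (Filter.Eventually.of_forall fun _ => ENNReal.ofReal_lt_top)]
  simp_rw [ENNReal.toReal_ofReal (u.chainDensity_nonneg σ K K o _), smul_eq_mul]

/-- Over a fixed product measure the parameter enters only the integrand, as differentiation under
the integral requires. -/
theorem compProd_chain (u : VelocityField d O) {σ : ℝ} (hσ : 0 < σ) (K : ℕ) (ν : Measure O)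
    [SFinite ν] :
    ν ⊗ₘ u.chain σ K K = (ν.prod (refMeasure d K)).withDensity fun y =>
      ENNReal.ofReal (u.chainDensity σ K K y.1 y.2) := by
  refine Measure.ext_of_lintegral _ fun f hf => ?_
  have hd := (u.measurable_chainDensity σ K K).ennreal_ofReal
  rw [Measure.lintegral_compProd hf, lintegral_withDensity_eq_lintegral_mul _ hd hf,
    lintegral_prod _ (hd.mul hf).aemeasurable]
  refine lintegral_congr fun o => ?_
  have hfo : Measurable fun x => f (o, x) := hf.comp measurable_prodMk_left
  rw [u.chain_eq_withDensity hσ, lintegral_withDensity_eq_lintegral_mul _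
    (u.measurable_chainDensity_right σ K K o).ennreal_ofReal hfo]
  rfl

theorem integral_policy (u : VelocityField d O) {σ : ℝ} (hσ : 0 < σ) (K : ℕ) (o : O)
    {f : Act d → ℝ} (hf : StronglyMeasurable f) :
    ∫ a, f a ∂u.policy σ K o =
      ∫ x, u.chainDensity σ K K o x * f (x (Fin.last K)) ∂refMeasure d K := by
  rw [policy, Kernel.map_apply _ (measurable_pi_apply (Fin.last K)),
    integral_map (measurable_pi_apply (Fin.last K)).aemeasurable hf.aestronglyMeasurable,
    u.integral_chain hσ]

theorem lintegral_policy (u : VelocityField d O) {σ : ℝ} (hσ : 0 < σ) (K : ℕ) (o : O)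
    {f : Act d → ℝ≥0∞} (hf : Measurable f) :
    ∫⁻ a, f a ∂u.policy σ K o = ∫⁻ x, ENNReal.ofReal (u.chainDensity σ K K o x) *
      f (x (Fin.last K)) ∂refMeasure d K := by
  have hfx : Measurable fun x : Fin (K + 1) → Act d => f (x (Fin.last K)) :=
    hf.comp (measurable_pi_apply (Fin.last K))
  rw [policy, Kernel.map_apply _ (measurable_pi_apply (Fin.last K)),
    lintegral_map hf (measurable_pi_apply (Fin.last K)), u.chain_eq_withDensity hσ,
    lintegral_withDensity_eq_lintegral_mul _
      (u.measurable_chainDensity_right σ K K o).ennreal_ofReal hfx]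
  rfl

/-- An envelope for the densities of the chains with parameters in the ball of radius `ε` about
`θ`, and a bound for their scores. -/
structure Envelope (u : EuclideanSpace ℝ (Fin p) → VelocityField d O) (σ : ℝ) (K : ℕ)
    (θ : EuclideanSpace ℝ (Fin p)) (ε : ℝ) (j : ℕ) where
  b : (Fin (K + 1) → Act d) → ℝ
  measurable : Measurable b
  nonneg : ∀ x, 0 ≤ b x
  S : ℝ
  S_nonneg : 0 ≤ S
  q : ℕ
  integrable : Integrable (fun x => b x * chainWeight x ^ (j + q)) (refMeasure d K)
  chainDensity_le : ∀ θ' ∈ Metric.ball θ ε, ∀ o x, (u θ').chainDensity σ K K o x ≤ b x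
  differentiableAt : ∀ θ' ∈ Metric.ball θ ε, ∀ o x,
    DifferentiableAt ℝ (logChainDensity u σ K o x) θ'
  norm_gradient_le : ∀ θ' ∈ Metric.ball θ ε, ∀ o x,
    ‖gradient (logChainDensity u σ K o x) θ'‖ ≤ S * chainWeight x ^ q
  hasGradientAt : ∀ θ' ∈ Metric.ball θ ε, ∀ o x,
    HasGradientAt (fun ϑ => (u ϑ).chainDensity σ K K o x)
      ((u θ').chainDensity σ K K o x • gradient (logChainDensity u σ K o x) θ') θ'

theorem nonempty_envelope {u : EuclideanSpace ℝ (Fin p) → VelocityField d O} {σ : ℝ}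
    (hσ : 0 < σ) {K : ℕ} {θ : EuclideanSpace ℝ (Fin p)} {ε C : ℝ} (hC : 0 ≤ C) {m : ℕ}
    (h : ∀ θ' ∈ Metric.ball θ ε, SmoothBound u K C m θ') (j : ℕ) :
    Nonempty (Envelope u σ K θ ε j) := by
  obtain ⟨b, hbm, hb0, hbi, hb⟩ :=
    exists_chainDensity_le (d := d) hσ K hC m O K le_rfl (j + (2 * m + 2))
  exact ⟨{
    b := b
    measurable := hbm
    nonneg := hb0
    S := K * ((σ ^ 2)⁻¹ * (1 + C) * C)
    S_nonneg := by positivity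
    q := 2 * m + 2
    integrable := hbi
    chainDensity_le := fun θ' hθ' => hb (u θ') (h θ' hθ').polyBound
    differentiableAt := fun θ' hθ' o x => ((h θ' hθ').logChainDensity hC hσ o x).1
    norm_gradient_le := fun θ' hθ' o x => ((h θ' hθ').logChainDensity hC hσ o x).2
    hasGradientAt := fun θ' hθ' o x => (h θ' hθ').hasGradientAt_chainDensity hC hσ o x }⟩

namespace Envelope

variable {u : EuclideanSpace ℝ (Fin p) → VelocityField d O} {σ : ℝ} {K : ℕ}
  {θ : EuclideanSpace ℝ (Fin p)} {ε : ℝ} {j : ℕ} (e : Envelope u σ K θ ε j)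

/-- The integral of the envelope against the chain weight to the power `j + q`. -/
noncomputable def mass : ℝ := ∫ x, e.b x * chainWeight x ^ (j + e.q) ∂refMeasure d K

theorem mass_nonneg : 0 ≤ e.mass :=
  integral_nonneg fun x => mul_nonneg (e.nonneg x)
    (pow_nonneg (zero_le_one.trans (one_le_chainWeight x)) _)

theorem pow_le_chainWeight_pow {n : ℕ} (x : Fin n → Act d) (i : Fin n) (j : ℕ) :
    (1 + ‖x i‖) ^ j ≤ chainWeight x ^ j := by
  have := one_add_norm_le_chainWeight x i
  gcongr

include e

theorem chainDensity_mul_abs_le {θ' : EuclideanSpace ℝ (Fin p)} (hθ' : θ' ∈ Metric.ball θ ε)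
    {c t : ℝ} (hc : 0 ≤ c) {x : Fin (K + 1) → Act d}
    (ht : |t| ≤ c * (1 + ‖x (Fin.last K)‖) ^ j) (o : O) :
    |(u θ').chainDensity σ K K o x * t| ≤ c * (e.b x * chainWeight x ^ (j + e.q)) := by
  have hW := one_le_chainWeight x
  have hb := e.nonneg x
  rw [abs_mul, abs_of_nonneg ((u θ').chainDensity_nonneg σ K K o x)]
  calc _ ≤ e.b x * (c * (1 + ‖x (Fin.last K)‖) ^ j) :=
        mul_le_mul (e.chainDensity_le θ' hθ' o x) ht (abs_nonneg _) hb
    _ ≤ e.b x * (c * chainWeight x ^ (j + e.q)) := by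
        gcongr
        exact (pow_le_chainWeight_pow x _ j).trans (pow_le_pow_right₀ hW (Nat.le_add_right _ _))
    _ = _ := by ring

theorem norm_gradient_chainDensity_le {θ' : EuclideanSpace ℝ (Fin p)}
    (hθ' : θ' ∈ Metric.ball θ ε) (o : O) (x : Fin (K + 1) → Act d) :
    ‖(u θ').chainDensity σ K K o x • gradient (logChainDensity u σ K o x) θ'‖ ≤
      e.S * (e.b x * chainWeight x ^ e.q) := by
  rw [norm_smul, Real.norm_of_nonneg ((u θ').chainDensity_nonneg σ K K o x)]
  refine (mul_le_mul (e.chainDensity_le θ' hθ' o x) (e.norm_gradient_le θ' hθ' o x)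
    (norm_nonneg _) (e.nonneg x)).trans_eq ?_
  ring

/-- Mean value inequality on the convex ball, where the gradient bound holds at every point. -/
theorem abs_chainDensity_sub_le {θ' : EuclideanSpace ℝ (Fin p)} (hθ' : θ' ∈ Metric.ball θ ε)
    (o : O) (x : Fin (K + 1) → Act d) :
    |(u θ').chainDensity σ K K o x - (u θ).chainDensity σ K K o x| ≤
      e.S * (e.b x * chainWeight x ^ e.q) * ‖θ' - θ‖ := by
  have hθ : θ ∈ Metric.ball θ ε :=
    Metric.mem_ball_self (dist_nonneg.trans_lt (Metric.mem_ball.1 hθ'))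
  refine Convex.norm_image_sub_le_of_norm_hasFDerivWithin_le
    (f := fun ϑ => (u ϑ).chainDensity σ K K o x) (s := Metric.ball θ ε)
    (fun y hy => (e.hasGradientAt y hy o x).hasFDerivAt.hasFDerivWithinAt) (fun y hy => ?_)
    (convex_ball θ ε) hθ hθ'
  rw [LinearIsometryEquiv.norm_map]
  exact e.norm_gradient_chainDensity_le hy o x

theorem lintegral_policy_le (hσ : 0 < σ) {θ' : EuclideanSpace ℝ (Fin p)}
    (hθ' : θ' ∈ Metric.ball θ ε) (o : O) {c : ℝ} (hc : 0 ≤ c) :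
    ∫⁻ a, ENNReal.ofReal (c * (1 + ‖a‖) ^ j) ∂(u θ').policy σ K o ≤
      ENNReal.ofReal (c * e.mass) := by
  rw [(u θ').lintegral_policy hσ K o (by fun_prop), mass, ← integral_const_mul,
    ofReal_integral_eq_lintegral_ofReal (e.integrable.const_mul c)]
  · refine lintegral_mono fun x => ?_
    rw [← ENNReal.ofReal_mul ((u θ').chainDensity_nonneg σ K K o x)]
    refine ENNReal.ofReal_le_ofReal ((le_abs_self _).trans
      (e.chainDensity_mul_abs_le hθ' hc ?_ o))
    rw [abs_of_nonneg (by positivity)]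
  · refine Filter.Eventually.of_forall fun x => ?_
    have := e.nonneg x
    have := one_le_chainWeight x
    simp only [Pi.zero_apply]
    positivity

theorem integrable_chainDensity_mul {θ' : EuclideanSpace ℝ (Fin p)}
    (hθ' : θ' ∈ Metric.ball θ ε) (o : O) {h : Act d → ℝ} (hm : Measurable h) {c : ℝ}
    (hc : 0 ≤ c) (hh : ∀ a, |h a| ≤ c * (1 + ‖a‖) ^ j) :
    Integrable (fun x => (u θ').chainDensity σ K K o x * h (x (Fin.last K)))
      (refMeasure d K) := by
  have hmx : Measurable fun x : Fin (K + 1) → Act d => h (x (Fin.last K)) :=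
    hm.comp (measurable_pi_apply _)
  exact (e.integrable.const_mul c).mono'
    (((u θ').measurable_chainDensity_right σ K K o).mul hmx).aestronglyMeasurable
    (Filter.Eventually.of_forall fun x => e.chainDensity_mul_abs_le hθ' hc (hh _) o)

theorem abs_integral_policy_sub_le (hσ : 0 < σ) {θ' : EuclideanSpace ℝ (Fin p)}
    (hθ' : θ' ∈ Metric.ball θ ε) (o : O) {h : Act d → ℝ} (hm : Measurable h) {c : ℝ}
    (hc : 0 ≤ c) (hh : ∀ a, |h a| ≤ c * (1 + ‖a‖) ^ j) :
    |∫ a, h a ∂(u θ').policy σ K o - ∫ a, h a ∂(u θ).policy σ K o| ≤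
      c * e.S * e.mass * ‖θ' - θ‖ := by
  have hθ : θ ∈ Metric.ball θ ε :=
    Metric.mem_ball_self (dist_nonneg.trans_lt (Metric.mem_ball.1 hθ'))
  rw [(u θ').integral_policy hσ K o hm.stronglyMeasurable,
    (u θ).integral_policy hσ K o hm.stronglyMeasurable,
    ← integral_sub (e.integrable_chainDensity_mul hθ' o hm hc hh)
      (e.integrable_chainDensity_mul hθ o hm hc hh), ← Real.norm_eq_abs]
  refine (norm_integral_le_of_norm_le (e.integrable.const_mul (c * e.S * ‖θ' - θ‖))
    (Filter.Eventually.of_forall fun x => ?_)).trans_eq ?_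
  · have hb := e.nonneg x
    have hS := e.S_nonneg
    have hW := one_le_chainWeight x
    rw [← sub_mul, norm_mul, Real.norm_eq_abs, Real.norm_eq_abs]
    calc _ ≤ (e.S * (e.b x * chainWeight x ^ e.q) * ‖θ' - θ‖) * (c * chainWeight x ^ j) := by
          refine mul_le_mul (e.abs_chainDensity_sub_le hθ' o x) ((hh _).trans ?_) (abs_nonneg _)
            (by positivity)
          have := pow_le_chainWeight_pow x (Fin.last K) j
          gcongr
      _ = _ := by ring
  · rw [integral_const_mul, mass]
    ring

theorem integral_integral_policy (hσ : 0 < σ) (ν : Measure O) [IsFiniteMeasure ν]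
    {θ' : EuclideanSpace ℝ (Fin p)} (hθ' : θ' ∈ Metric.ball θ ε) {g : O × Act d → ℝ}
    (hg : Measurable g) {c : ℝ} (hc : 0 ≤ c) (hgc : ∀ o a, |g (o, a)| ≤ c * (1 + ‖a‖) ^ j) :
    ∫ o, ∫ a, g (o, a) ∂(u θ').policy σ K o ∂ν =
      ∫ y : O × (Fin (K + 1) → Act d), (u θ').chainDensity σ K K y.1 y.2 *
        g (y.1, y.2 (Fin.last K)) ∂ν.prod (refMeasure d K) := by
  have hgl : Measurable fun y : O × (Fin (K + 1) → Act d) => g (y.1, y.2 (Fin.last K)) :=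
    hg.comp (measurable_fst.prodMk ((measurable_pi_apply _).comp measurable_snd))
  rw [integral_prod]
  · refine integral_congr_ae (Filter.Eventually.of_forall fun o => ?_)
    exact (u θ').integral_policy hσ K o (hg.comp measurable_prodMk_left).stronglyMeasurable
  · exact ((e.integrable.const_mul c).comp_snd ν).mono'
      (((u θ').measurable_chainDensity σ K K).mul hgl).aestronglyMeasurable
      (Filter.Eventually.of_forall fun y => e.chainDensity_mul_abs_le hθ' hc (hgc _ _) _)

/-- The score-function identity for a test function `g` and an observation law `ν` that do not vary
with the parameter. The envelope times `c * S` dominates the derivative throughout the ball. -/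
theorem integrable_and_hasGradientAt (hσ : 0 < σ) (hε : 0 < ε) (ν : Measure O)
    [IsFiniteMeasure ν] {g : O × Act d → ℝ} (hg : Measurable g) {c : ℝ} (hc : 0 ≤ c)
    (hgc : ∀ o a, |g (o, a)| ≤ c * (1 + ‖a‖) ^ j) :
    Integrable (fun y : O × (Fin (K + 1) → Act d) =>
      g (y.1, y.2 (Fin.last K)) • gradient (logChainDensity u σ K y.1 y.2) θ)
      (ν ⊗ₘ (u θ).chain σ K K) ∧
    HasGradientAt (fun ϑ => ∫ y : O × (Fin (K + 1) → Act d),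
        (u ϑ).chainDensity σ K K y.1 y.2 * g (y.1, y.2 (Fin.last K)) ∂ν.prod (refMeasure d K))
      (∫ y : O × (Fin (K + 1) → Act d),
        g (y.1, y.2 (Fin.last K)) • gradient (logChainDensity u σ K y.1 y.2) θ
          ∂(ν ⊗ₘ (u θ).chain σ K K)) θ := by
  have hθ : θ ∈ Metric.ball θ ε := Metric.mem_ball_self hε
  have hgl : Measurable fun y : O × (Fin (K + 1) → Act d) => g (y.1, y.2 (Fin.last K)) :=
    hg.comp (measurable_fst.prodMk ((measurable_pi_apply _).comp measurable_snd))
  have hgrad : Measurable fun y : O × (Fin (K + 1) → Act d) =>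
      gradient (logChainDensity u σ K y.1 y.2) θ :=
    measurable_gradient_of_measurable (fun ϑ => measurable_logChainDensity u hσ K ϑ)
      fun y => e.differentiableAt θ hθ y.1 y.2
  set F' : EuclideanSpace ℝ (Fin p) → O × (Fin (K + 1) → Act d) → EuclideanSpace ℝ (Fin p) :=
    fun ϑ y => g (y.1, y.2 (Fin.last K)) •
      ((u ϑ).chainDensity σ K K y.1 y.2 • gradient (logChainDensity u σ K y.1 y.2) ϑ) with hF'
  have hF'm : Measurable (F' θ) :=
    hgl.smul (((u θ).measurable_chainDensity σ K K).smul hgrad)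
  have hbound (y : O × (Fin (K + 1) → Act d)) (θ' : EuclideanSpace ℝ (Fin p))
      (hθ' : θ' ∈ Metric.ball θ ε) :
      ‖F' θ' y‖ ≤ c * e.S * (e.b y.2 * chainWeight y.2 ^ (j + e.q)) := by
    have hb := e.nonneg y.2
    have hS := e.S_nonneg
    have hW := one_le_chainWeight y.2
    rw [hF', norm_smul, Real.norm_eq_abs]
    calc _ ≤ (c * chainWeight y.2 ^ j) * (e.S * (e.b y.2 * chainWeight y.2 ^ e.q)) := by
          refine mul_le_mul ((hgc _ _).trans ?_) (e.norm_gradient_chainDensity_le hθ' _ _)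
            (norm_nonneg _) (by positivity)
          have := pow_le_chainWeight_pow y.2 (Fin.last K) j
          gcongr
      _ = _ := by ring
  have hbi : Integrable (fun y : O × (Fin (K + 1) → Act d) =>
      c * e.S * (e.b y.2 * chainWeight y.2 ^ (j + e.q))) (ν.prod (refMeasure d K)) :=
    (e.integrable.const_mul (c * e.S)).comp_snd ν
  have hF'i : Integrable (F' θ) (ν.prod (refMeasure d K)) :=
    hbi.mono' hF'm.aestronglyMeasurable (Filter.Eventually.of_forall fun y => hbound y θ hθ)
  have hdens := ((u θ).measurable_chainDensity σ K K).ennreal_ofReal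
  have hfun : (fun y : O × (Fin (K + 1) → Act d) =>
      (ENNReal.ofReal ((u θ).chainDensity σ K K y.1 y.2)).toReal •
        g (y.1, y.2 (Fin.last K)) • gradient (logChainDensity u σ K y.1 y.2) θ) = F' θ := by
    funext y
    rw [ENNReal.toReal_ofReal ((u θ).chainDensity_nonneg σ K K _ _), smul_comm]
  rw [(u θ).compProd_chain hσ, integrable_withDensity_iff_integrable_smul' hdens
    (Filter.Eventually.of_forall fun _ => ENNReal.ofReal_lt_top),
    integral_withDensity_eq_integral_toReal_smul hdens
    (Filter.Eventually.of_forall fun _ => ENNReal.ofReal_lt_top), hfun]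
  refine ⟨hF'i, ?_⟩
  rw [hasGradientAt_iff_hasFDerivAt]
  have hFm (ϑ : EuclideanSpace ℝ (Fin p)) : Measurable fun y : O × (Fin (K + 1) → Act d) =>
      (u ϑ).chainDensity σ K K y.1 y.2 * g (y.1, y.2 (Fin.last K)) :=
    ((u ϑ).measurable_chainDensity σ K K).mul hgl
  -- Dominated differentiation yields an integral of functionals; the Riesz isometry commutes with
  -- the integral and returns the gradient form.
  have hcomm : InnerProductSpace.toDual ℝ (EuclideanSpace ℝ (Fin p))
      (∫ y, F' θ y ∂ν.prod (refMeasure d K)) =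
      ∫ y, InnerProductSpace.toDual ℝ (EuclideanSpace ℝ (Fin p)) (F' θ y)
        ∂ν.prod (refMeasure d K) :=
    (ContinuousLinearMap.integral_comp_comm (InnerProductSpace.toDual ℝ
      (EuclideanSpace ℝ (Fin p))).toContinuousLinearEquiv.toContinuousLinearMap hF'i).symm
  rw [hcomm]
  refine hasFDerivAt_integral_of_dominated_of_fderiv_le (s := Metric.ball θ ε)
    (bound := fun y => c * e.S * (e.b y.2 * chainWeight y.2 ^ (j + e.q)))
    (F' := fun ϑ y => InnerProductSpace.toDual ℝ (EuclideanSpace ℝ (Fin p)) (F' ϑ y))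
    (Metric.ball_mem_nhds θ hε)
    (Filter.Eventually.of_forall fun ϑ => (hFm ϑ).aestronglyMeasurable) ?_ ?_ ?_ hbi ?_
  · exact ((e.integrable.const_mul c).comp_snd ν).mono' (hFm θ).aestronglyMeasurable
      (Filter.Eventually.of_forall fun y => e.chainDensity_mul_abs_le hθ hc (hgc _ _) _)
  · exact (LinearIsometryEquiv.continuous _).comp_aestronglyMeasurable hF'm.aestronglyMeasurable
  · refine Filter.Eventually.of_forall fun y θ' hθ' => ?_
    rw [LinearIsometryEquiv.norm_map]
    exact hbound y θ' hθ'
  · refine Filter.Eventually.of_forall fun y θ' hθ' => ?_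
    have := (e.hasGradientAt θ' hθ' y.1 y.2).hasFDerivAt.mul_const (g (y.1, y.2 (Fin.last K)))
    rwa [← map_smul] at this

end Envelope

end VelocityField

/-! ### Lipschitz dependence of the visitation measure on the parameter. -/

namespace MDP

variable {O A : Type*} [MeasurableSpace O] [MeasurableSpace A]

/-- The environment of `M`, with reward `f` depending on the observation only. -/
def withObsReward (M : MDP O A) (f : O → ℝ) (hf : Measurable f) : MDP O A where
  __ := M
  reward o _ := f o
  measurable_reward := hf.comp measurable_fst

variable {M : MDP O A} {f : O → ℝ} {hf : Measurable f}

theorem dominatedBy_withObsReward (π : Kernel O A) [IsMarkovKernel π] {β : ℝ≥0}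
    (hβ : ∀ o, ‖f o‖₊ ≤ β) : (M.withObsReward f hf).DominatedBy π (fun _ => β) β where
  measurable := measurable_const
  reward_le o _ := hβ o
  lintegral_le o := by simp

/-- Changing the reward leaves the visitation measure unchanged, so an integral against it is itself
an expected return, to which the performance difference lemma applies. -/
theorem J_withObsReward (π : Kernel O A) [IsMarkovKernel π] {β : ℝ≥0} (hβ : ∀ o, ‖f o‖₊ ≤ β) :
    (M.withObsReward f hf).J π = ∫ o, f o ∂M.visitation π := by
  have h := dominatedBy_withObsReward (M := M) (hf := hf) π hβ
  have hi := h.integrable_reward (h.lintegral_init_le.trans_lt ENNReal.coe_lt_top)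
  rw [h.J_eq_integral_occupancy]
  rw [← visitation_compProd] at hi ⊢
  rw [Measure.integral_compProd hi]
  change ∫ o, ∫ _, f o ∂π o ∂M.visitation π = _
  simp

theorem lintegral_absReturn_lt_top {π : Kernel O A} [IsMarkovKernel π] {w : A → ℝ≥0} {B : ℝ≥0}
    (h : M.DominatedBy π w B) {μ : Measure (O × A)} [IsProbabilityMeasure μ]
    (hμ : ∫⁻ x, w x.2 ∂μ < ∞) : ∫⁻ ω, M.absReturn ω ∂M.rolloutFrom π μ < ∞ := by
  rw [lintegral_absReturn]
  exact (h.integrable_reward hμ).2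

theorem visitation_real_univ (M : MDP O A) (π : Kernel O A) [IsMarkovKernel π] :
    (M.visitation π).real Set.univ = (1 - M.γ)⁻¹ := by
  rw [measureReal_def, visitation_univ, ENNReal.toReal_ofReal]
  exact inv_nonneg.2 (sub_nonneg.2 M.γ_lt_one.le)

end MDP

namespace VelocityField.Envelope

variable {d p : ℕ} {O : Type*} [MeasurableSpace O]
  {u : EuclideanSpace ℝ (Fin p) → VelocityField d O} {σ : ℝ} {K : ℕ}
  {θ : EuclideanSpace ℝ (Fin p)} {ε : ℝ} {j : ℕ}

/-- Take `f` as a reward: the difference is then one of returns, hence an integral of the averaged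
advantage. That average vanishes under the policy at `θ`, so under the policy at `θ'` it is `O(‖θ' -
θ‖)` uniformly in `o`. The factor `2 * (β + β * (1 - γ)⁻¹)` bounds the advantage, and the final `(1
- γ)⁻¹` is the mass of the visitation measure. -/
theorem abs_integral_visitation_sub_le (e : Envelope u σ K θ ε j) (hσ : 0 < σ)
    (M : MDP O (Act d)) {θ' : EuclideanSpace ℝ (Fin p)} (hθ' : θ' ∈ Metric.ball θ ε) {f : O → ℝ}
    (hf : Measurable f) {β : ℝ} (hβ : 0 ≤ β) (hfβ : ∀ o, |f o| ≤ β) :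
    |∫ o, f o ∂M.visitation ((u θ').policy σ K) - ∫ o, f o ∂M.visitation ((u θ).policy σ K)| ≤
      2 * (β + β * (1 - M.γ)⁻¹) * e.S * e.mass * ‖θ' - θ‖ * (1 - M.γ)⁻¹ := by
  lift β to ℝ≥0 using hβ
  have hγ : 0 ≤ (1 - M.γ)⁻¹ := inv_nonneg.2 (sub_nonneg.2 M.γ_lt_one.le)
  have h (ϑ : EuclideanSpace ℝ (Fin p)) := MDP.dominatedBy_withObsReward (M := M) (hf := hf)
    ((u ϑ).policy σ K) (fun o => hfβ o)
  rw [← MDP.J_withObsReward (hf := hf) _ (fun o => hfβ o),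
    ← MDP.J_withObsReward (hf := hf) _ (fun o => hfβ o), MDP.performance_difference (h θ) (h θ')]
  set N := M.withObsReward f hf with hN
  have hA (o : O) (a : Act d) : |N.advantage ((u θ).policy σ K) o a| ≤
      2 * (β + β * (1 - M.γ)⁻¹) * (1 + ‖a‖) ^ j := by
    have h1 := (h θ).abs_advantage_le o a
    have h2 : (1 : ℝ) ≤ (1 + ‖a‖) ^ j := one_le_pow₀ (by simp)
    have h3 : 0 ≤ 2 * (β + β * (1 - M.γ)⁻¹) := by positivity
    calc _ ≤ _ := h1
      _ = 2 * (β + β * (1 - M.γ)⁻¹) * 1 := by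
        change (β : ℝ) + (β + 2 * (β * (1 - M.γ)⁻¹)) = _
        ring
      _ ≤ _ := by gcongr
  have hAm := MDP.stronglyMeasurable_advantage N ((u θ).policy σ K)
  have hAi : Integrable (fun x : O × Act d => N.advantage ((u θ).policy σ K) x.1 x.2)
      (N.visitation ((u θ').policy σ K) ⊗ₘ (u θ').policy σ K) :=
    (integrable_const _).mono' hAm.aestronglyMeasurable
      (Filter.Eventually.of_forall fun x => (h θ).abs_advantage_le x.1 x.2)
  rw [Measure.integral_compProd hAi, ← Real.norm_eq_abs]
  have hv : (N.visitation ((u θ').policy σ K)).real Set.univ = (1 - M.γ)⁻¹ :=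
    N.visitation_real_univ _
  rw [← hv]
  refine norm_integral_le_of_norm_le_const (Filter.Eventually.of_forall fun o => ?_)
  have h4 := e.abs_integral_policy_sub_le hσ hθ' o
    (hAm.measurable.comp (measurable_prodMk_left (x := o))) (by positivity) (hA o)
  simp only [Function.comp_apply, (h θ).integral_advantage_eq_zero, sub_zero] at h4
  rw [hv]
  exact h4

end VelocityField.Envelope

/-! ### Assembly of the policy gradient formula. -/

theorem mainTheorem1 {d p K : ℕ} (hK : 0 < K) {σ : ℝ} (hσ : 0 < σ)
    {O : Type*} [MeasurableSpace O] (M : MDP O (Act d))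
    (u : EuclideanSpace ℝ (Fin p) → VelocityField d O) (θ : EuclideanSpace ℝ (Fin p))
    -- the reward grows at most polynomially in the action
    (hr : ∃ (C : ℝ) (m : ℕ), ∀ (o : O) (a : Act d), |M.reward o a| ≤ C * (1 + ‖a‖) ^ m)
    -- near `θ` the network is differentiable in the parameters, and the network and its parameter
    -- derivative grow at most polynomially in the denoising state
    (hu : ∃ ε > 0, ∃ (C : ℝ) (m : ℕ), ∀ θ' ∈ Metric.ball θ ε, ∀ k < K, ∀ (a : Act d) (o : O),
      DifferentiableAt ℝ
        (fun ϑ => (u ϑ).toFun a (flowTime K (k + 1)) (flowTime K k) o) θ' ∧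
      ‖(u θ').toFun a (flowTime K (k + 1)) (flowTime K k) o‖ ≤ C * (1 + ‖a‖) ^ m ∧
      ‖fderiv ℝ (fun ϑ => (u ϑ).toFun a (flowTime K (k + 1)) (flowTime K k) o) θ'‖
        ≤ C * (1 + ‖a‖) ^ m) :
    -- near `θ` the returns that define `J`, `V` and `Q` converge absolutely in expectation
    (∀ᶠ θ' in nhds θ,
      ∫⁻ ω, M.absReturn ω ∂(M.rollout ((u θ').policy σ K)) < ⊤ ∧
      (∀ o, ∫⁻ ω, M.absReturn ω ∂(M.rolloutFromObs ((u θ').policy σ K) o) < ⊤) ∧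
      (∀ o a, ∫⁻ ω, M.absReturn ω ∂(M.rolloutFromPair ((u θ').policy σ K) (o, a)) < ⊤)) ∧
    -- the expectation in the policy gradient exists
    Integrable
      (fun x : O × (Fin (K + 1) → Act d) =>
        M.advantage ((u θ).policy σ K) x.1 (x.2 (Fin.last K)) •
          gradient (fun ϑ => ∑ k : Fin K, Real.log
            ((u ϑ).transitionDensity σ K k x.1 (x.2 k.castSucc) (x.2 k.succ))) θ)
      (M.visitation ((u θ).policy σ K) ⊗ₘ (u θ).chain σ K K) ∧
    -- the policy gradient formula
    HasGradientAt (fun ϑ => M.J ((u ϑ).policy σ K))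
      (∫ x : O × (Fin (K + 1) → Act d),
        M.advantage ((u θ).policy σ K) x.1 (x.2 (Fin.last K)) •
          gradient (fun ϑ => ∑ k : Fin K, Real.log
            ((u ϑ).transitionDensity σ K k x.1 (x.2 k.castSucc) (x.2 k.succ))) θ
        ∂(M.visitation ((u θ).policy σ K) ⊗ₘ (u θ).chain σ K K)) θ := by

  obtain ⟨Cr, mr, hr⟩ := hr
  obtain ⟨ε, hε, Cu, mu, hu⟩ := hu
  have hsmooth : ∀ θ' ∈ Metric.ball θ ε, VelocityField.SmoothBound u K (max Cu 0) mu θ' := by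
    intro θ' hθ'
    have hle (a : Act d) : Cu * (1 + ‖a‖) ^ mu ≤ max Cu 0 * (1 + ‖a‖) ^ mu := by
      gcongr
      exact le_max_left _ _
    exact ⟨fun k hk a o => (hu θ' hθ' k hk a o).2.1.trans (hle a),
      fun k hk a o => (hu θ' hθ' k hk a o).1,
      fun k hk a o => (hu θ' hθ' k hk a o).2.2.trans (hle a)⟩
  -- The moment order is `mr` because the advantage inherits the growth of the reward.
  obtain ⟨e⟩ := VelocityField.nonempty_envelope hσ (le_max_right Cu 0) hsmooth mr
  set C := max Cr 0 with hCdef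
  have hC : 0 ≤ C := le_max_right _ _
  have hrC (o : O) (a : Act d) : |M.reward o a| ≤ C * (1 + ‖a‖) ^ mr :=
    (hr o a).trans (by gcongr; exact le_max_left _ _)
  have hθ : θ ∈ Metric.ball θ ε := Metric.mem_ball_self hε
  set w : Act d → ℝ≥0 := fun a => (C * (1 + ‖a‖) ^ mr).toNNReal with hw
  set B : ℝ≥0 := (C * e.mass).toNNReal with hB
  have hdom : ∀ θ' ∈ Metric.ball θ ε, M.DominatedBy ((u θ').policy σ K) w B := by
    intro θ' hθ'
    refine ⟨by fun_prop, fun o a => ?_, fun o => e.lintegral_policy_le hσ hθ' o hC⟩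
    rw [hw, Real.le_toNNReal_iff_coe_le (by positivity)]
    exact hrC o a
  have hγ : 0 ≤ (1 - M.γ)⁻¹ := inv_nonneg.2 (sub_nonneg.2 M.γ_lt_one.le)
  set A : O × Act d → ℝ := fun x => M.advantage ((u θ).policy σ K) x.1 x.2 with hAdef
  have hAm : Measurable A := (MDP.stronglyMeasurable_advantage M ((u θ).policy σ K)).measurable
  set c : ℝ := C + (B + 2 * (B * (1 - M.γ)⁻¹)) with hcdef
  have hc : 0 ≤ c := by positivity
  have hA (o : O) (a : Act d) : |A (o, a)| ≤ c * (1 + ‖a‖) ^ mr := by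
    have h1 := (hdom θ hθ).abs_advantage_le o a
    have h2 : (1 : ℝ) ≤ (1 + ‖a‖) ^ mr := one_le_pow₀ (by simp)
    have h3 : 0 ≤ (B + 2 * (B * (1 - M.γ)⁻¹) : ℝ) := by positivity
    rw [hw, Real.coe_toNNReal _ (by positivity)] at h1
    refine h1.trans ?_
    rw [hcdef, add_mul]
    nlinarith
  obtain ⟨hint, hgrad⟩ := e.integrable_and_hasGradientAt hσ hε
    (M.visitation ((u θ).policy σ K)) hAm hc hA
  refine ⟨?_, hint, ?_⟩
  · filter_upwards [Metric.ball_mem_nhds θ hε] with θ' hθ'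
    have h := hdom θ' hθ'
    refine ⟨?_, fun o => ?_, fun o a => ?_⟩
    · rw [MDP.rollout_eq]
      exact MDP.lintegral_absReturn_lt_top h (h.lintegral_init_le.trans_lt ENNReal.coe_lt_top)
    · rw [MDP.rolloutFromObs_apply]
      exact MDP.lintegral_absReturn_lt_top h ((h.lintegral_map_mk_le o).trans_lt ENNReal.coe_lt_top)
    · rw [← MDP.rolloutFrom_dirac]
      exact MDP.lintegral_absReturn_lt_top h (h.lintegral_dirac_lt_top (o, a))
  set f : EuclideanSpace ℝ (Fin p) → O → ℝ := fun θ' o => ∫ a, A (o, a) ∂(u θ').policy σ K o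
    with hf
  have hfm (θ' : EuclideanSpace ℝ (Fin p)) : Measurable (f θ') :=
    (StronglyMeasurable.integral_kernel_prod_right' hAm.stronglyMeasurable).measurable
  have hfθ (o : O) : f θ o = 0 := (hdom θ hθ).integral_advantage_eq_zero o
  have hfle (θ' : EuclideanSpace ℝ (Fin p)) (hθ' : θ' ∈ Metric.ball θ ε) (o : O) :
      |f θ' o| ≤ c * e.S * e.mass * ‖θ' - θ‖ := by
    have := e.abs_integral_policy_sub_le hσ hθ' o
      (hAm.comp (measurable_prodMk_left (x := o))) hc (hA o)
    simp only [Function.comp_apply] at this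
    have h0 := hfθ o
    simp only [hf] at h0 ⊢
    rwa [h0, sub_zero] at this
  set L : ℝ := c * e.S * e.mass with hL
  have hL0 : 0 ≤ L := mul_nonneg (mul_nonneg hc e.S_nonneg) e.mass_nonneg
  set Φ : EuclideanSpace ℝ (Fin p) → ℝ := fun ϑ =>
    ∫ o, f ϑ o ∂M.visitation ((u θ).policy σ K) with hΦ
  have hΦgrad : HasGradientAt Φ _ θ := hgrad.congr_of_eventuallyEq (by
    filter_upwards [Metric.ball_mem_nhds θ hε] with θ' hθ'
    exact e.integral_integral_policy hσ _ hθ' hAm hc hA)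
  -- On the ball, `R ϑ` is the integral of `f ϑ` against the difference of the visitation measures
  -- at `ϑ` and `θ`: a function and a measure that are both small of first order.
  set R : EuclideanSpace ℝ (Fin p) → ℝ := fun ϑ =>
    M.J ((u ϑ).policy σ K) - M.J ((u θ).policy σ K) - Φ ϑ with hR
  set D : ℝ := 2 * (L + L * (1 - M.γ)⁻¹) * e.S * e.mass * (1 - M.γ)⁻¹ with hD
  have hRle (θ' : EuclideanSpace ℝ (Fin p)) (hθ' : θ' ∈ Metric.ball θ ε) :
      |R θ'| ≤ D * ‖θ' - θ‖ ^ 2 := by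
    have hAi : Integrable A (M.visitation ((u θ').policy σ K) ⊗ₘ (u θ').policy σ K) := by
      refine (hdom θ hθ).integrable_of_bound ?_ hAm.stronglyMeasurable
        (fun x => (hdom θ hθ).abs_advantage_le x.1 x.2)
      refine ((hdom θ' hθ').lintegral_compProd_le _).trans_lt ?_
      exact ENNReal.mul_lt_top ENNReal.coe_lt_top (measure_lt_top _ _)
    have h1 : M.J ((u θ').policy σ K) - M.J ((u θ).policy σ K) =
        ∫ o, f θ' o ∂M.visitation ((u θ').policy σ K) := by
      rw [MDP.performance_difference (hdom θ hθ) (hdom θ' hθ')]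
      exact Measure.integral_compProd hAi
    rw [hR]
    simp only [h1, hΦ]
    -- The sup bound `β = L * ‖θ' - θ‖` supplies the second factor `‖θ' - θ‖`.
    refine (e.abs_integral_visitation_sub_le hσ M hθ' (hfm θ')
      (mul_nonneg hL0 (norm_nonneg (θ' - θ))) (hfle θ' hθ')).trans_eq ?_
    rw [hD]
    ring
  have hΦθ : Φ θ = 0 := by simp [hΦ, hfθ]
  have hRθ : R θ = 0 := by simp [hR, hΦθ]
  have hRgrad : HasFDerivAt R (0 : EuclideanSpace ℝ (Fin p) →L[ℝ] ℝ) θ := by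
    rw [hasFDerivAt_iff_isLittleO_nhds_zero]
    have hO : (fun h => R (θ + h) - R θ - (0 : EuclideanSpace ℝ (Fin p) →L[ℝ] ℝ) h) =O[nhds 0]
        fun h : EuclideanSpace ℝ (Fin p) => ‖h‖ ^ 2 := by
      refine Asymptotics.IsBigO.of_bound D ?_
      filter_upwards [Metric.ball_mem_nhds (0 : EuclideanSpace ℝ (Fin p)) hε] with h hh
      have := hRle (θ + h) (by simpa using hh)
      simpa [hRθ] using this
    exact hO.trans_isLittleO (Asymptotics.isLittleO_norm_pow_id one_lt_two)
  have hJ : (fun ϑ => M.J ((u ϑ).policy σ K)) = fun ϑ =>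
      M.J ((u θ).policy σ K) + (Φ ϑ + R ϑ) := by
    funext ϑ
    simp only [hR]
    ring
  rw [hJ, hasGradientAt_iff_hasFDerivAt]
  have := (hΦgrad.hasFDerivAt.add hRgrad).const_add (M.J ((u θ).policy σ K))
  rw [add_zero] at this
  exact this
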